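/- **Setting.** Let $n\ge 1$, $d\ge 1$, let $\mathcal Y$ be a finite label set, $\mathcal X\subseteq\mathbb R^d$ and $\mathcal W\subseteq\mathbb R^{d\times|\mathcal Y|}$. Let $S_i=(X_i,Y_i)$, $i\in[n+1]$, be random elements of $\mathcal X\times\mathcal Y$, with $S_{[i]}=(S_1,\dots,S_i)$, $S_{(i,n]}=(S_{i+1},\dots,S_n)$, $S_{[i,n]}=(S_i,\dots,S_n)$; let $A=(A_{i,j})_{n\times n}$ be a random adjacency matrix of a finite simple graph on $[n]$, with values in a set $\mathcal A$, and let $A_{n+1,[n+1]}$ be a random vector in $\mathbb R^{n+1}$ (the aggregation coefficients of a new node). Regular versions $P_{S_i\mid S_{[i-1]}}$ of the one-step conditional laws are fixed, and all conditional laws of later data points given earlier ones are the ones composed from them. For an adjacency matrix $a$ with degrees $D_i$, put $\tilde a_{i,j}=a_{i,j}/(\sqrt{D_i+1}\sqrt{D_j+1})$ for $j\ne i$, $\tilde a_{i,i}=1/(D_i+1)$, and $\hat a_{i,j}=a_{i,j}/(\sqrt{D_i}\sqrt{D_j})$ for $j\neq i$, with $\hat a_{i,j}=0$ if $a_{i,j}=0$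 or $j=i$. Let $\phi:\mathbb R\to\mathbb R$ be a $1$-Lipschitz activation (such as ReLU or the identity), applied coordinatewise, and let the outputs of the one-layer GCN at node $j\in[n]$ and at the new node be $$f_{W,j}(X_{[n]},\tilde A)=\phi\Big(\sum_{k=1}^n\tilde A_{j,k}X_kW\Big),\qquad f_W(X_{[n+1]},A_{n+1,[n+1]})=\phi\Big(\sum_{k=1}^{n+1}A_{n+1,k}X_kW\Big).$$ For a loss $\ell:\mathbb R^{|\mathcal Y|}\times\mathcal Y\to[0,\infty)$ let $$\mathcal E_2(W,S_{[n]},A)=\mathbb E\big[\ell(f_W(X_{[n+1]},A_{n+1,[n+1]}),Y_{n+1})\,\big|\,S_{[n]},A\big]-\frac1n\sum_{j=1}^n\mathbb E_{S_{[j,n]}\mid S_{[j-1]}}\big[\ell(f_{W,j}(X_{[n]},\tilde A),Y_j)\big],$$ where in the sum $A$ is held fixed and $S_{[j,n]}$ is integrated against its conditional law given $S_{[j-1]}$. Let $Q_{A_{n+1,[n+1]}\mid A}$ be the auxiliary law $\frac1n\sum_{i=1}^n\delta_{v_i}$, where $v_i\in\mathbb R^{n+1}$ has coordinates $(v_i)_k=\tilde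 A_{i,k}$ for $k\in[n]\setminus\{i\}$, $(v_i)_i=0$, $(v_i)_{n+1}=\tilde A_{i,i}$. Let ${\rm D}_{\rm TV}(\mu,\nu)=\sup_B|\mu(B)-\nu(B)|$, and for $Q\ll P$ let ${\rm D}_\alpha(Q\|P)=\frac1{\alpha-1}\log\mathbb E_P[(dQ/dP)^\alpha]$. Let $\boldsymbol\Gamma,\widetilde{\boldsymbol\Gamma}\in\mathbb R^{n\times n}$ have the following entries. $\Gamma_{i,i}=1$, $\Gamma_{i,j}=0$ for $i>j$, and for $i<j$, $\Gamma_{i,j}$ is the supremum of ${\rm D}_{\rm TV}(P_{S_{[j,n]}\mid S_{[i]}=x_{[i]}},P_{S_{[j,n]}\mid S_{[i]}=z_{[i]}})$ over all $x,z\in(\mathcal X\times\mathcal Y)^n$ that differ at most in coordinate $i$. $\widetilde\Gamma_{i,j}=0$ for $i\ge j$, and for $i<j$, $\widetilde\Gamma_{i,j}$ is the supremum of ${\rm D}_{\rm TV}(P_{S_{[j,n]}\mid S_{[j-1]}=x_{[j-1]}},P_{S_{[j,n]}\mid S_{[j-1]}=z_{[j-1]}})$ over the same pairs. $\|\boldsymbol\Gamma\|$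 is the spectral norm and $\|\widetilde{\boldsymbol\Gamma}\|_\infty$ the maximal absolute row sum. **Assumptions.** There are positive constants $c_x,c_a,c_w,L,M$ with $\|x\|_2\le c_x$ on $\mathcal X$; $\|\tilde a\|_{\rm F},\|\hat a\|_{\rm F}\le c_a$ for all $a\in\mathcal A$; the spectral norm of $w$ is at most $c_w$ for all $w\in\mathcal W$; $|\ell(\hat y,y)-\ell(\hat y',y)|\le L\|\hat y-\hat y'\|_2$; and $0\le\ell\le M$. Moreover $S_{[n]}$ is independent of $A$, and $P_{S_{n+1},A_{n+1,[n+1]}\mid S_{[n]},A}=P_{S_{n+1}\mid S_{[n]}}\otimes P_{A_{n+1,[n+1]}\mid A}$ almost surely. **Claim.** Let $P$ be a (data-independent) probability measure on $\mathcal W$. For any $\delta\in(0,1)$, any $\alpha\in(0,1)\cup(1,\infty)$, and any posterior $Q$, that is, a probability measure $Q\ll P$ on $\mathcal W$ which may depend on $(S_{[n]},A)$, with probability at least $1-\delta/2$ over $S_{[n]}$ and $A$, $$\begin{aligned}\mathbb E_{W\sim Q}\big[\mathcal E_2(W,S_{[n]},A)\big]\le{}&\frac Mn\sum_{i=1}^n{\rm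 D}_{\rm TV}\big(P_{S_{n+1}\mid S_{[n]}},P_{S_i\mid S_{[i-1]}}\big)\\&+\frac Mn\sum_{i=1}^n\mathbb E_{S_{[i-1]}}\Big[{\rm D}_{\rm TV}\big(P_{S_{(i,n]}\mid S_{[i-1]}}\otimes P_{S_i\mid S_{[i-1]}},P_{S_{[i,n]}\mid S_{[i-1]}}\big)\Big]\\&+M\,{\rm D}_{\rm TV}\big(P_{A_{n+1,[n+1]}\mid A},Q_{A_{n+1,[n+1]}\mid A}\big)\\&+\sqrt{\frac{(2c_xc_wc_aL+M\|\widetilde{\boldsymbol\Gamma}\|_\infty)^2\big({\rm D}_\alpha(Q\|P)+\log(2\sqrt{2n}/\delta)\big)\|\boldsymbol\Gamma\|^2}{2n-1}}.\end{aligned}$$ The right-hand side is read as $+\infty$ when ${\rm D}_\alpha(Q\|P)=\infty$. -/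

import Mathlib

open MeasureTheory ProbabilityTheory
open scoped ENNReal NNReal

noncomputable section

namespace GCN

/-! ### Total variation and Rényi divergence -/

/-- Total variation distance `sup_A |P(A) - Q(A)|` over measurable sets `A`. -/
def tvDist {α : Type*} [MeasurableSpace α] (P Q : Measure α) : ℝ :=
  ⨆ A : {A : Set α // MeasurableSet A}, |P.real A.1 - Q.real A.1|

/-- Rényi divergence `D_a(Q‖P) = (a - 1)⁻¹ * log E_P[(dQ/dP)^a]` for `Q ≪ P`, with values in the
extended reals (it may be `+∞` when `a > 1`). -/
def renyiDiv {α : Type*} [MeasurableSpace α] (a : ℝ) (Q P : Measure α) : EReal :=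
  (((a - 1)⁻¹ : ℝ) : EReal) * ENNReal.log (∫⁻ w, (Q.rnDeriv P w) ^ a ∂P)

/-! ### Conditional laws of a finite sequence, built from the one-step conditional laws

Indices start at `0`: `κ i` is the law of the `i`-th point given the points `0, …, i - 1`. -/

section Path

variable {T : Type*} [MeasurableSpace T]

lemma measurable_snoc (n : ℕ) :
    Measurable (fun p : (Fin n → T) × T => (Fin.snoc p.1 p.2 : Fin (n + 1) → T)) := by
  refine measurable_pi_lambda _ fun k => ?_
  refine Fin.lastCases ?_ (fun k => ?_) k
  · simpa using measurable_snd
  · have h : Measurable (fun p : (Fin n → T) × T => p.1 k) :=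
      (measurable_pi_apply k).comp measurable_fst
    simpa using h

lemma measurable_castLE {m n : ℕ} (h : m ≤ n) :
    Measurable (fun (x : Fin n → T) (k : Fin m) => x (Fin.castLE h k)) :=
  measurable_pi_lambda _ fun _ => measurable_pi_apply _

/-- One step of the sequence: keep the first `n` points and draw the next one from `κ n`. -/
def stepKernel (κ : (i : ℕ) → Kernel (Fin i → T) T) (n : ℕ) :
    Kernel (Fin n → T) (Fin (n + 1) → T) :=
  (Kernel.id ×ₖ κ n).map (fun p : (Fin n → T) × T => (Fin.snoc p.1 p.2 : Fin (n + 1) → T))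

/-- `pathLaw κ i n x` is the conditional law of the first `n` points given that the first `i` points
are equal to `x` (for `i ≤ n`; for `n ≤ i` it is the point mass at the first `n` entries of `x`). -/
def pathLaw (κ : (i : ℕ) → Kernel (Fin i → T) T) (i : ℕ) :
    (n : ℕ) → Kernel (Fin i → T) (Fin n → T)
  | 0 => Kernel.deterministic (fun x (k : Fin 0) => x (Fin.castLE (Nat.zero_le i) k))
      (measurable_castLE _)
  | n + 1 =>
      if h : n + 1 ≤ i then
        Kernel.deterministic (fun x (k : Fin (n + 1)) => x (Fin.castLE h k)) (measurable_castLE h)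
      else stepKernel κ n ∘ₖ pathLaw κ i n

instance (κ : (i : ℕ) → Kernel (Fin i → T) T) [∀ i, IsMarkovKernel (κ i)] (n : ℕ) :
    IsMarkovKernel (stepKernel κ n) := by
  unfold stepKernel
  exact Kernel.IsMarkovKernel.map _ (measurable_snoc n)

instance (κ : (i : ℕ) → Kernel (Fin i → T) T) [∀ i, IsMarkovKernel (κ i)] (i n : ℕ) :
    IsMarkovKernel (pathLaw κ i n) := by
  induction n with
  | zero => unfold pathLaw; infer_instance
  | succ n ih => unfold pathLaw; split <;> infer_instance

/-- Conditional law of the points `j, …, n - 1` given that the first `i` points are equal to `x`. -/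
def futureLaw (κ : (i : ℕ) → Kernel (Fin i → T) T) (i n j : ℕ) (x : Fin i → T) :
    Measure ({k : Fin n // j ≤ (k : ℕ)} → T) :=
  (pathLaw κ i n x).map (fun s k => s k.1)

/-- Given the first `i` points `x`: the joint conditional law of the pair formed by the
points `i + 1, …, n - 1` and the point `i`. -/
def jointLaw (κ : (i : ℕ) → Kernel (Fin i → T) T) {n : ℕ} (i : Fin n) (x : Fin i → T) :
    Measure (({k : Fin n // (i : ℕ) + 1 ≤ (k : ℕ)} → T) × T) :=
  (pathLaw κ i n x).map (fun s => (fun k => s k.1, s i))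

/-- Given the first `i` points `x`: the product of the conditional law of the points
`i + 1, …, n - 1` and the conditional law of the point `i`. -/
def productLaw (κ : (i : ℕ) → Kernel (Fin i → T) T) {n : ℕ} (i : Fin n) (x : Fin i → T) :
    Measure (({k : Fin n // (i : ℕ) + 1 ≤ (k : ℕ)} → T) × T) :=
  (futureLaw κ i n (i + 1) x).prod (κ i x)

/-- Pairs of sequences that differ at most in coordinate `i`. -/
abbrev DifferAt (T : Type*) {n : ℕ} (i : Fin n) : Type _ :=
  {p : (Fin n → T) × (Fin n → T) // ∀ k, k ≠ i → p.1 k = p.2 k}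

/-- The dependency matrix `Γ`: for `i < j`, the largest effect of changing point `i` on the law of
the points `j, …, n - 1` given the points `0, …, i`. -/
def Gam (κ : (i : ℕ) → Kernel (Fin i → T) T) (n : ℕ) : Matrix (Fin n) (Fin n) ℝ := fun i j =>
  if j < i then 0
  else if i = j then 1
  else ⨆ p : DifferAt T i,
    tvDist (futureLaw κ (i + 1) n j (Fin.take (i + 1) i.2 p.1.1))
      (futureLaw κ (i + 1) n j (Fin.take (i + 1) i.2 p.1.2))

/-- The dependency matrix `Γ̃`: for `i < j`, the largest effect of changing only point `i` among
the points `0, …, j - 1` on the law of the points `j, …, n - 1` given the points `0, …, j - 1`. -/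
def GamTilde (κ : (i : ℕ) → Kernel (Fin i → T) T) (n : ℕ) : Matrix (Fin n) (Fin n) ℝ := fun i j =>
  if i < j then ⨆ p : DifferAt T i,
    tvDist (futureLaw κ j n j (Fin.take j j.2.le p.1.1))
      (futureLaw κ j n j (Fin.take j j.2.le p.1.2))
  else 0

end Path

/-! ### Matrix norms -/

/-- Matrices carry the product (that is, Borel) sigma-algebra. -/
instance {m n : Type*} : MeasurableSpace (Matrix m n ℝ) :=
  inferInstanceAs (MeasurableSpace (m → n → ℝ))

/-- Spectral norm (largest singular value). -/
def specNorm {m n : Type*} [Fintype m] [Fintype n] [DecidableEq n] (A : Matrix m n ℝ) : ℝ :=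
  ‖LinearMap.toContinuousLinearMap (Matrix.toEuclideanLin A)‖

/-- Frobenius norm. -/
def frobNorm {m n : Type*} [Fintype m] [Fintype n] (A : Matrix m n ℝ) : ℝ :=
  Real.sqrt (∑ i, ∑ j, A i j ^ 2)

/-- The norm `‖A‖_∞`, the largest absolute row sum. -/
def rowSumNorm {m n : Type*} [Fintype n] (A : Matrix m n ℝ) : ℝ :=
  ⨆ i, ∑ j, |A i j|

/-! ### Normalized adjacency matrices -/

section Graph

open Classical in
/-- Entries of the adjacency matrix. -/
def adj {n : ℕ} (g : SimpleGraph (Fin n)) (i j : Fin n) : ℝ := if g.Adj i j then 1 else 0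

/-- Degree of a node. -/
def deg {n : ℕ} (g : SimpleGraph (Fin n)) (i : Fin n) : ℝ := ∑ j, adj g i j

/-- Normalized adjacency matrix with self-connections. -/
def normAdjSelf {n : ℕ} (g : SimpleGraph (Fin n)) : Matrix (Fin n) (Fin n) ℝ := fun i j =>
  if j = i then 1 / (deg g i + 1)
  else adj g i j / (Real.sqrt (deg g i + 1) * Real.sqrt (deg g j + 1))

/-- Normalized adjacency matrix without self-connections. -/
def normAdj {n : ℕ} (g : SimpleGraph (Fin n)) : Matrix (Fin n) (Fin n) ℝ := fun i j =>
  if j = i then 0 else adj g i j / (Real.sqrt (deg g i) * Real.sqrt (deg g j))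

/-- The coefficients of node `i`, transferred to the new node: coordinate `k ≠ i` is that of
node `i`, coordinate `i` is `0`, and the last coordinate is the self-coefficient of node `i`. -/
def auxCoeff {n : ℕ} (g : SimpleGraph (Fin n)) (i : Fin n) : Fin (n + 1) → ℝ :=
  Fin.snoc (Function.update (normAdjSelf g i) i 0) (normAdjSelf g i i)

/-- The auxiliary law of the aggregation coefficients of the new node: mass `1/n` on each of the
vectors `auxCoeff g i`. -/
def auxLaw {n : ℕ} (g : SimpleGraph (Fin n)) : Measure (Fin (n + 1) → ℝ) :=
  ∑ i : Fin n, ((n : ℝ≥0∞)⁻¹) • Measure.dirac (auxCoeff g i)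

end Graph

/-! ### The one-layer GCN -/

section Model

variable {d : ℕ} {Y : Type*} [Fintype Y]

/-- Data points: pairs (features, label), with features in the set `X`. -/
abbrev DataPt (X : Set (EuclideanSpace ℝ (Fin d))) (Y : Type*) : Type _ := X × Y

/-- Output `φ (∑ k, a k • x k W)` of a node with aggregation coefficients `a`; the features are row
vectors and `φ` acts on each coordinate. -/
def output (φ : ℝ → ℝ) (W : Matrix (Fin d) Y ℝ) {m : ℕ}
    (x : Fin m → EuclideanSpace ℝ (Fin d)) (a : Fin m → ℝ) : EuclideanSpace ℝ Y :=
  WithLp.toLp 2 fun y => φ (∑ k, a k * ∑ l, x k l * W l y)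

variable [MeasurableSpace Y] {X : Set (EuclideanSpace ℝ (Fin d))}

/-- The expected risk: `ρ (s, g)` is the conditional law of the new data point and of its
aggregation coefficients, given the data points `s` and the graph `g`. -/
def risk (φ : ℝ → ℝ) (ℓ : EuclideanSpace ℝ Y → Y → ℝ) {n : ℕ}
    (ρ : Kernel ((Fin n → DataPt X Y) × SimpleGraph (Fin n)) (DataPt X Y × (Fin (n + 1) → ℝ)))
    (W : Matrix (Fin d) Y ℝ) (s : Fin n → DataPt X Y) (g : SimpleGraph (Fin n)) : ℝ :=
  ∫ p, ℓ (output φ W (fun k => ((Fin.snoc s p.1 : Fin (n + 1) → DataPt X Y) k).1) p.2) p.1.2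
    ∂(ρ (s, g))

/-- The part `E₂` of the generalization gap: the expected risk minus the average over `j` of the
conditional expectation, given the points before `j`, of the loss at node `j`. -/
def gapTwo (φ : ℝ → ℝ) (ℓ : EuclideanSpace ℝ Y → Y → ℝ) {n : ℕ}
    (κ : (i : ℕ) → Kernel (Fin i → DataPt X Y) (DataPt X Y))
    (ρ : Kernel ((Fin n → DataPt X Y) × SimpleGraph (Fin n)) (DataPt X Y × (Fin (n + 1) → ℝ)))
    (W : Matrix (Fin d) Y ℝ) (s : Fin n → DataPt X Y) (g : SimpleGraph (Fin n)) : ℝ :=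
  risk φ ℓ ρ W s g
    - (1 / n) * ∑ j : Fin n,
        ∫ t, ℓ (output φ W (fun k => (t k).1) (normAdjSelf g j)) (t j).2
          ∂(pathLaw κ j n (Fin.take j j.2.le s))

end Model

end GCN

end

/-!
The proof bounds the gap uniformly in the parameter: after the two total variation corrections, what
is left at node `j` is at most `L ‖W‖` times `GCN.meanDist`, the mean distance of the aggregated later
features to an independent continuation. Its exponential moments are controlled by a
Hoeffding-Azuma argument along the sequence, with oscillations bounded by the matrix `Γ`. The
divergence of the posterior, `Γ̃` and the middle total variation term enter only as nonnegative terms.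
-/

namespace GCN

/-! ### Conditional path laws: tower property and marginals. -/

section PathLemmas

variable {T : Type*} [MeasurableSpace T]

/-! Fix the data `s`, the graph and a parameter `W`. Replacing the law of the new node's
coefficients by `auxLaw` costs `M` times a total variation distance. Under `auxLaw` the new node
plays the role of a node `i`, with its own point put in place of `s i` (`sum_auxCoeff`). Drawing
that point from `κ i` instead of `κ n` costs the `i`-th term of the first sum in the bound. The
point can then be taken as coordinate `i` of a random continuation `t` of the points of `s` before
`i`. The two losses at node `i` now differ only through the later points, `s k` against `t k` for `k
> i`, and the Lipschitz properties give `gapTwo_le`. The remainder involves `W` only through its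
spectral norm, so the bound is uniform in `W` and survives averaging over any posterior without a
change of measure.

It remains to bound the sum over nodes of `meanDist`. Given the first `j` points, `s` and its
continuation are independent with the same law. Along the sequence, the Doob martingale of a
1-Lipschitz function of `∑ a k • ξ (s k)` has a `k`-th step of oscillation at most `2 c (Γ|a|)_k`
(`integral_lipschitz_sub_le`). The same oscillations control the fluctuations, through Hoeffding's
lemma, and the mean, through the variance of a Hilbert-space-valued martingale. With `σ = c ‖Γ‖ b`,
where `b` bounds the Euclidean norm of `a`, the mean is at most `2σ` and the variance proxy is `σ²`
(`integral_exp_mean_dist_le`). A weighted Jensen inequality adds up the nodes without any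
independence between them, and Chernoff's bound at level `(2 + √(2 log (2/δ))) σ` gives probability
`δ/2`.

The remaining work is numerical. The later coefficients carry at most half of the squared Frobenius
norm, and the self-connections gain a factor `(n-1)/n`. The additional `2` coming from the mean is
absorbed by the term `log (2n) / 2` contained in `log (2√(2n)/δ)` (`sq_mul_two_add_sq_le`). -/

lemma measurable_take {m n : ℕ} (h : m ≤ n) :
    Measurable (fun x : Fin n → T => (Fin.take m h x : Fin m → T)) :=
  measurable_castLE h

lemma pathLaw_self (κ : (i : ℕ) → Kernel (Fin i → T) T) (n : ℕ) :
    pathLaw κ n n = Kernel.id := by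
  cases n with
  | zero => rfl
  | succ n =>
    rw [pathLaw, dif_pos le_rfl]
    rfl

lemma pathLaw_succ (κ : (i : ℕ) → Kernel (Fin i → T) T) {i n : ℕ} (h : i ≤ n) :
    pathLaw κ i (n + 1) = stepKernel κ n ∘ₖ pathLaw κ i n := by
  rw [pathLaw, dif_neg (by omega)]

/-- Chapman–Kolmogorov: conditioning may stop at any intermediate time `j`. -/
lemma pathLaw_comp (κ : (i : ℕ) → Kernel (Fin i → T) T) {i j n : ℕ} (hij : i ≤ j) (hjn : j ≤ n) :
    pathLaw κ i n = pathLaw κ j n ∘ₖ pathLaw κ i j := by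
  induction n, hjn using Nat.le_induction with
  | base => rw [pathLaw_self, Kernel.id_comp]
  | succ n hjn ih => rw [pathLaw_succ κ (hij.trans hjn), pathLaw_succ κ hjn, ih, Kernel.comp_assoc]

variable (κ : (i : ℕ) → Kernel (Fin i → T) T) [∀ i, IsMarkovKernel (κ i)]

lemma stepKernel_apply (n : ℕ) (x : Fin n → T) :
    stepKernel κ n x = (κ n x).map (fun t => (Fin.snoc x t : Fin (n + 1) → T)) := by
  rw [stepKernel, Kernel.map_apply _ (measurable_snoc n), Kernel.prod_apply, Kernel.id_apply,
    Measure.dirac_prod, Measure.map_map (measurable_snoc n) measurable_prodMk_left]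
  rfl

lemma measurable_snoc_right {n : ℕ} (x : Fin n → T) :
    Measurable (fun t : T => (Fin.snoc x t : Fin (n + 1) → T)) :=
  (measurable_snoc n).comp measurable_prodMk_left

lemma pathLaw_succ_self (n : ℕ) (x : Fin n → T) :
    pathLaw κ n (n + 1) x = (κ n x).map (fun t => (Fin.snoc x t : Fin (n + 1) → T)) := by
  rw [pathLaw_succ κ le_rfl, pathLaw_self, Kernel.comp_id, stepKernel_apply]

/-- One-step tower property, the form in which the martingale inductions reveal a single point. The
uniform bound serves only integrability. -/
lemma integral_pathLaw_step {E : Type*} [NormedAddCommGroup E] [NormedSpace ℝ E]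
    {k n : ℕ} (hk : k < n) (x : Fin k → T)
    {F : (Fin n → T) → E} (hF : StronglyMeasurable F) {C : ℝ} (hC : ∀ s, ‖F s‖ ≤ C) :
    ∫ s, F s ∂(pathLaw κ k n x)
      = ∫ t, ∫ s, F s ∂(pathLaw κ (k + 1) n (Fin.snoc x t)) ∂(κ k x) := by
  rw [pathLaw_comp κ (Nat.le_succ k) hk, Kernel.integral_comp, pathLaw_succ_self,
    integral_map (measurable_snoc_right x).aemeasurable]
  · exact hF.integral_kernel.aestronglyMeasurable
  · exact Integrable.of_bound hF.aestronglyMeasurable C (.of_forall hC)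

lemma stepKernel_map_init (n : ℕ) (x : Fin n → T) :
    (stepKernel κ n x).map (Fin.take n n.le_succ) = Measure.dirac x := by
  rw [stepKernel_apply, Measure.map_map (measurable_take _) (measurable_snoc_right x)]
  have : (Fin.take n n.le_succ ∘ fun t => (Fin.snoc x t : Fin (n + 1) → T)) = fun _ => x := by
    funext t k
    change (Fin.snoc x t : Fin (n + 1) → T) k.castSucc = x k
    simp
  rw [this, Measure.map_const]
  simp

/-- Under `pathLaw κ i n`, the first `j` points have law `pathLaw κ i j`. -/
lemma pathLaw_map_take {i j n : ℕ} (hij : i ≤ j) (hjn : j ≤ n) (x : Fin i → T) :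
    (pathLaw κ i n x).map (Fin.take j hjn) = pathLaw κ i j x := by
  induction n, hjn using Nat.le_induction with
  | base =>
    have : (Fin.take j le_rfl : (Fin j → T) → (Fin j → T)) = id := by
      funext s; exact Fin.take_eq_self s
    rw [this, Measure.map_id]
  | succ n hjn ih =>
    have h1 : (Fin.take j (hjn.trans n.le_succ) : (Fin (n + 1) → T) → (Fin j → T))
        = Fin.take j hjn ∘ Fin.take n n.le_succ := by
      funext s; rfl
    rw [h1, ← Measure.map_map (measurable_take hjn) (measurable_take n.le_succ)]
    have h2 : (pathLaw κ i (n + 1) x).map (Fin.take n n.le_succ) = pathLaw κ i n x := by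
      rw [← Kernel.map_apply _ (measurable_take _), pathLaw_succ κ (hij.trans hjn), Kernel.map_comp]
      have h3 : (stepKernel κ n).map (Fin.take n n.le_succ) = Kernel.id := by
        ext1 y
        rw [Kernel.map_apply _ (measurable_take _), stepKernel_map_init, Kernel.id_apply]
      rw [h3, Kernel.id_comp]
    rw [h2, ih]

/-- The first `i` points have the point mass at `x` as their law. This allows the past to be treated
as frozen inside integrals. -/
lemma ae_take_eq [MeasurableSingletonClass T] {i n : ℕ} (hin : i ≤ n) (x : Fin i → T) :
    ∀ᵐ s ∂(pathLaw κ i n x), Fin.take i hin s = x := by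
  have h := pathLaw_map_take κ le_rfl hin x
  rw [pathLaw_self, Kernel.id_apply] at h
  have h2 : ∀ᵐ y ∂((pathLaw κ i n x).map (Fin.take i hin)), y = x := by
    rw [h, ae_dirac_eq]; rfl
  exact ae_of_ae_map (measurable_take hin).aemeasurable h2

/-- Under `pathLaw κ i n`, the point `i` has law `κ i`. -/
lemma pathLaw_map_eval {n : ℕ} (i : Fin n) (x : Fin i → T) :
    (pathLaw κ i n x).map (fun s => s i) = κ i x := by
  have h := pathLaw_map_take κ (Nat.le_succ i) i.2 x
  rw [pathLaw_succ_self] at h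
  have h1 : (fun s : Fin n → T => s i)
      = (fun y : Fin (i + 1) → T => y (Fin.last i)) ∘ Fin.take (i + 1) i.2 := by
    funext s; rfl
  rw [h1, ← Measure.map_map (measurable_pi_apply _) (measurable_take _)]
  simp only [Nat.succ_eq_add_one] at h
  rw [h, Measure.map_map (measurable_pi_apply _) (measurable_snoc_right x)]
  convert Measure.map_id
  funext t
  simp

/-- The law of a random sequence with one-step conditional laws `κ`. -/
lemma map_eq_pathLaw {Ω : Type*} [MeasurableSpace Ω] (μ : Measure Ω) [IsProbabilityMeasure μ]
    {N : ℕ} (S : Fin N → Ω → T) (hS : ∀ i, Measurable (S i))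
    (hκ : ∀ i : Fin N, HasCondDistrib (S i) (fun ω => Fin.take i i.2.le (fun k => S k ω)) (κ i) μ)
    {n : ℕ} (hn : n ≤ N) (x₀ : Fin 0 → T) :
    μ.map (fun ω => Fin.take n hn (fun k => S k ω)) = pathLaw κ 0 n x₀ := by
  have hm : ∀ {m : ℕ} (h : m ≤ N), Measurable (fun ω => Fin.take m h (fun k => S k ω)) :=
    fun h => (measurable_take h).comp (measurable_pi_lambda _ hS)
  induction n with
  | zero =>
    rw [pathLaw_self, Kernel.id_apply]
    have : (fun ω => Fin.take 0 hn (fun k => S k ω)) = fun _ => x₀ := by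
      funext ω; exact Subsingleton.elim _ _
    rw [this, Measure.map_const]; simp
  | succ n ih =>
    have h := (hκ ⟨n, hn⟩).map_eq
    simp only at h
    have h1 : (fun ω => Fin.take (n + 1) hn (fun k => S k ω))
        = (fun p : (Fin n → T) × T => (Fin.snoc p.1 p.2 : Fin (n + 1) → T)) ∘
          (fun ω => (Fin.take n (Nat.le_of_succ_le hn) (fun k => S k ω), S ⟨n, hn⟩ ω)) := by
      funext ω
      exact Fin.take_succ_eq_snoc n hn _
    rw [h1, ← Measure.map_map (measurable_snoc n) ((hm _).prodMk (hS _)), h,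
      ih (Nat.le_of_succ_le hn), pathLaw_succ κ (Nat.zero_le n), Measure.compProd_eq_comp_prod,
      Measure.map_comp _ _ (measurable_snoc n), ← stepKernel, Kernel.comp_apply]

end PathLemmas

/-! ### Total variation and differences of expectations. -/

section TotalVariation

variable {Z : Type*} [MeasurableSpace Z]

lemma abs_real_sub_real_le_one (P Q : Measure Z) [IsProbabilityMeasure P] [IsProbabilityMeasure Q]
    (A : Set Z) : |P.real A - Q.real A| ≤ 1 := by
  have h1 : P.real A ≤ 1 := measureReal_le_one
  have h2 : Q.real A ≤ 1 := measureReal_le_one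
  have h3 : 0 ≤ P.real A := measureReal_nonneg
  have h4 : 0 ≤ Q.real A := measureReal_nonneg
  rw [abs_le]; constructor <;> linarith

lemma tvDist_nonneg (P Q : Measure Z) : 0 ≤ tvDist P Q :=
  Real.iSup_nonneg fun _ => abs_nonneg _

lemma tvDist_le_one (P Q : Measure Z) [IsProbabilityMeasure P] [IsProbabilityMeasure Q] :
    tvDist P Q ≤ 1 :=
  Real.iSup_le (fun A => abs_real_sub_real_le_one P Q A.1) zero_le_one

lemma real_sub_real_le_tvDist (P Q : Measure Z) [IsProbabilityMeasure P] [IsProbabilityMeasure Q]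
    {A : Set Z} (hA : MeasurableSet A) : P.real A - Q.real A ≤ tvDist P Q := by
  refine (le_abs_self _).trans ?_
  exact le_ciSup (f := fun A : {A : Set Z // MeasurableSet A} => |P.real A.1 - Q.real A.1|)
    ⟨1, by rintro _ ⟨A, rfl⟩; exact abs_real_sub_real_le_one P Q A.1⟩ ⟨A, hA⟩

/-- A function with values in `[0, c]` has expectations that differ by at most `c` times the total
variation distance. -/
lemma integral_sub_integral_le_tvDist (P Q : Measure Z) [IsProbabilityMeasure P]
    [IsProbabilityMeasure Q] {f : Z → ℝ} (hf : Measurable f) {c : ℝ} (hc : 0 ≤ c)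
    (h0 : ∀ z, 0 ≤ f z) (h1 : ∀ z, f z ≤ c) :
    ∫ z, f z ∂P - ∫ z, f z ∂Q ≤ c * tvDist P Q := by
  -- On `H` the measure `P` dominates `Q`, and on the complement `Q` dominates `P`. Since `f ≥ 0`,
  -- the complement contributes at most `0` to the difference; since `c - f ≥ 0`, the set `H`
  -- contributes at most `c (P H - Q H)`.
  obtain ⟨H, hH, hle, hge⟩ := hahn_decomposition P Q
  have hint : ∀ (R : Measure Z) [IsProbabilityMeasure R], Integrable f R := fun R _ =>
    Integrable.of_bound hf.aestronglyMeasurable c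
      (.of_forall fun z => by rw [Real.norm_of_nonneg (h0 z)]; exact h1 z)
  have hr1 : Q.restrict H ≤ P.restrict H := Measure.le_iff.2 fun t ht => by
    rw [Measure.restrict_apply ht, Measure.restrict_apply ht]
    exact hle _ (ht.inter hH) Set.inter_subset_right
  have hr2 : P.restrict Hᶜ ≤ Q.restrict Hᶜ := Measure.le_iff.2 fun t ht => by
    rw [Measure.restrict_apply ht, Measure.restrict_apply ht]
    exact hge _ (ht.inter hH.compl) Set.inter_subset_right
  have h2 : ∫ z in Hᶜ, f z ∂P ≤ ∫ z in Hᶜ, f z ∂Q :=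
    integral_mono_measure hr2 (.of_forall h0) (hint Q).integrableOn
  have h3 : ∫ z in H, (c - f z) ∂Q ≤ ∫ z in H, (c - f z) ∂P :=
    integral_mono_measure hr1 (.of_forall fun z => sub_nonneg.2 (h1 z))
      ((integrable_const c).sub (hint P)).integrableOn
  have h4 : ∀ (ν : Measure Z) [IsProbabilityMeasure ν],
      ∫ z in H, (c - f z) ∂ν = c * ν.real H - ∫ z in H, f z ∂ν := fun ν _ => by
    rw [integral_sub (integrable_const c) (hint ν).integrableOn]
    simp [mul_comm]
  rw [h4 P, h4 Q] at h3
  have h5 := real_sub_real_le_tvDist P Q hH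
  rw [← integral_add_compl hH (hint P), ← integral_add_compl hH (hint Q)]
  nlinarith [mul_le_mul_of_nonneg_left h5 hc]

/-- Adding `c` moves the values into `[0, 2c]`, whence the factor `2`. -/
lemma integral_sub_integral_le_of_abs_le (P Q : Measure Z) [IsProbabilityMeasure P]
    [IsProbabilityMeasure Q] {f : Z → ℝ} (hf : Measurable f) {c : ℝ} (hc : 0 ≤ c)
    (h : ∀ z, |f z| ≤ c) :
    ∫ z, f z ∂P - ∫ z, f z ∂Q ≤ 2 * c * tvDist P Q := by
  have hint : ∀ (R : Measure Z) [IsProbabilityMeasure R], Integrable f R := fun R _ =>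
    Integrable.of_bound hf.aestronglyMeasurable c (.of_forall h)
  have := integral_sub_integral_le_tvDist P Q (f := fun z => f z + c) (hf.add_const c)
    (c := 2 * c) (by positivity) (fun z => by linarith [(abs_le.1 (h z)).1])
    (fun z => by linarith [(abs_le.1 (h z)).2])
  rw [integral_add (hint P) (integrable_const c), integral_add (hint Q) (integrable_const c)]
    at this
  simpa using this

end TotalVariation

/-! ### Sensitivity of conditional expectations to one past point. -/

section Oscillation

/-- The weighted sum `∑ k, a k • ξ (s k)` of a feature `ξ` along a sequence `s`. -/
def wsum {T E : Type*} [NormedAddCommGroup E] [NormedSpace ℝ E] (ξ : T → E) {n : ℕ}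
    (a : Fin n → ℝ) (s : Fin n → T) : E := ∑ k, a k • ξ (s k)

lemma norm_wsum_le {T E : Type*} [NormedAddCommGroup E] [NormedSpace ℝ E] {ξ : T → E} {c : ℝ}
    (hc : ∀ t, ‖ξ t‖ ≤ c) {n : ℕ} (a : Fin n → ℝ) (s : Fin n → T) :
    ‖wsum ξ a s‖ ≤ ∑ k, |a k| * c := by
  refine (norm_sum_le _ _).trans (Finset.sum_le_sum fun k _ => ?_)
  rw [norm_smul, Real.norm_eq_abs]
  exact mul_le_mul_of_nonneg_left (hc _) (abs_nonneg _)

lemma abs_lipschitz_wsum_le {T E : Type*} [NormedAddCommGroup E] [NormedSpace ℝ E]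
    {ξ : T → E} {c : ℝ} (hc : ∀ t, ‖ξ t‖ ≤ c) {n : ℕ} (a : Fin n → ℝ)
    {ψ : E → ℝ} (hψ : LipschitzWith 1 ψ) (s : Fin n → T) :
    |ψ (wsum ξ a s)| ≤ |ψ 0| + ∑ k, |a k| * c := by
  have h := hψ.dist_le_mul (wsum ξ a s) 0
  rw [dist_zero_right, Real.dist_eq, NNReal.coe_one, one_mul] at h
  have h2 := abs_sub_abs_le_abs_sub (ψ (wsum ξ a s)) (ψ 0)
  linarith [norm_wsum_le hc a s]

/-- Weights restricted to the indices `≥ m`. -/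
def tailWeights {n : ℕ} (a : Fin n → ℝ) (m : ℕ) (k : Fin n) : ℝ := if m ≤ k then a k else 0

lemma wsum_tailWeights_succ {T E : Type*} [NormedAddCommGroup E] [NormedSpace ℝ E] (ξ : T → E)
    {n : ℕ} (a : Fin n → ℝ) {m : ℕ} (hm : m < n) (s : Fin n → T) :
    wsum ξ (tailWeights a m) s = a ⟨m, hm⟩ • ξ (s ⟨m, hm⟩) + wsum ξ (tailWeights a (m + 1)) s := by
  have h : ∀ k : Fin n, tailWeights a m k • ξ (s k)
      = (if k = ⟨m, hm⟩ then a k • ξ (s k) else 0) + tailWeights a (m + 1) k • ξ (s k) := by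
    intro k
    unfold tailWeights
    rcases lt_trichotomy (k : ℕ) m with h | h | h
    · rw [if_neg (by omega), if_neg (by rw [Fin.ext_iff]; simp; omega), if_neg (by omega)]; simp
    · rw [if_pos (by omega), if_pos (by rw [Fin.ext_iff]; simpa using h), if_neg (by omega)]; simp
    · rw [if_pos (by omega), if_neg (by rw [Fin.ext_iff]; simp; omega), if_pos (by omega)]; simp
  unfold wsum
  rw [Finset.sum_congr rfl fun k _ => h k, Finset.sum_add_distrib]
  simp

variable {T : Type*} [MeasurableSpace T]

lemma Gam_self (κ : (i : ℕ) → Kernel (Fin i → T) T) (n : ℕ) (i : Fin n) : Gam κ n i i = 1 := by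
  simp [Gam]

variable (κ : (i : ℕ) → Kernel (Fin i → T) T) [∀ i, IsMarkovKernel (κ i)]

instance (i n j : ℕ) (x : Fin i → T) : IsProbabilityMeasure (futureLaw κ i n j x) := by
  unfold futureLaw
  exact Measure.isProbabilityMeasure_map
    (measurable_pi_lambda _ fun _ => measurable_pi_apply _).aemeasurable

/-- A real supremum is an upper bound only for a bounded family; total variation being at most `1`
supplies this. -/
lemma tvDist_futureLaw_le_Gam {n : ℕ} {k m : Fin n} (hkm : k < m) (x z : Fin n → T)
    (hxz : ∀ l, l ≠ k → x l = z l) :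
    tvDist (futureLaw κ (k + 1) n m (Fin.take (k + 1) k.2 x))
      (futureLaw κ (k + 1) n m (Fin.take (k + 1) k.2 z)) ≤ Gam κ n k m := by
  rw [Gam, if_neg (by simpa using hkm.le), if_neg hkm.ne]
  exact le_ciSup (f := fun p : DifferAt T k =>
    tvDist (futureLaw κ (k + 1) n m (Fin.take (k + 1) k.2 p.1.1))
      (futureLaw κ (k + 1) n m (Fin.take (k + 1) k.2 p.1.2)))
    ⟨1, by rintro _ ⟨p, rfl⟩; exact tvDist_le_one _ _⟩ ⟨(x, z), hxz⟩

variable {E : Type*} [NormedAddCommGroup E] [NormedSpace ℝ E] [MeasurableSpace E] [BorelSpace E]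
  [SecondCountableTopology E]

lemma measurable_wsum {ξ : T → E} (hξ : Measurable ξ) {n : ℕ} (a : Fin n → ℝ) :
    Measurable (wsum ξ a) :=
  Finset.measurable_fun_sum _ fun k _ => (hξ.comp (measurable_pi_apply k)).const_smul (a k)

lemma measurable_lipschitz_wsum {ξ : T → E} (hξ : Measurable ξ) {n : ℕ} (a : Fin n → ℝ)
    {ψ : E → ℝ} (hψ : LipschitzWith 1 ψ) : Measurable fun s => ψ (wsum ξ a s) :=
  hψ.continuous.measurable.comp (measurable_wsum hξ a)

lemma integrable_lipschitz_wsum {ξ : T → E} (hξ : Measurable ξ) {c : ℝ} (hc : ∀ t, ‖ξ t‖ ≤ c)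
    {n : ℕ} (a : Fin n → ℝ) {ψ : E → ℝ} (hψ : LipschitzWith 1 ψ) (P : Measure (Fin n → T))
    [IsProbabilityMeasure P] : Integrable (fun s => ψ (wsum ξ a s)) P :=
  Integrable.of_bound (measurable_lipschitz_wsum hξ a hψ).aestronglyMeasurable _
    (.of_forall (abs_lipschitz_wsum_le hc a hψ))

/-- The expectation of a `1`-Lipschitz function of the points `m, …, n - 1` changes by a controlled
amount when the point `k < m` of the past is changed. -/
lemma integral_tail_sub_le {ξ : T → E} (hξ : Measurable ξ) {c : ℝ} (hc0 : 0 ≤ c)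
    (hc : ∀ t, ‖ξ t‖ ≤ c) {n : ℕ} (a : Fin n → ℝ) {ψ : E → ℝ} (hψ : LipschitzWith 1 ψ)
    {k : Fin n} (x z : Fin n → T) (hxz : ∀ l, l ≠ k → x l = z l) {m : ℕ} (hm : m ≤ n)
    (hkm : (k : ℕ) < m) :
    ∫ s, ψ (wsum ξ (tailWeights a m) s) ∂(pathLaw κ (k + 1) n (Fin.take (k + 1) k.2 x))
      - ∫ s, ψ (wsum ξ (tailWeights a m) s) ∂(pathLaw κ (k + 1) n (Fin.take (k + 1) k.2 z))
      ≤ 2 * c * ∑ l : Fin n, if m ≤ l then Gam κ n k l * |a l| else 0 := by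
  -- Induction on the number of tail points. Peeling off point `m` leaves an increment of size at
  -- most `|a m| c` that depends only on the points from `m` on, so that the entry `Γ k m` weighs
  -- it.
  induction hd : n - m generalizing m with
  | zero =>
    obtain rfl : m = n := by omega
    have h0 : ∀ l : Fin m, tailWeights a m l = 0 := fun l => if_neg (by omega)
    have h1 : ∀ l : Fin m, ¬ (m ≤ (l : ℕ)) := fun l => by omega
    simp [wsum, h0, h1]
  | succ d ih =>
    have hm' : m < n := by omega
    specialize ih (m := m + 1) hm' (by omega) (by omega)
    let mm : Fin n := ⟨m, hm'⟩
    have hkmm : k < mm := hkm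
    -- The weighted sum as a function of the points from `m` on alone, so that its integrals factor
    -- through `futureLaw`.
    let R : (Fin n → ℝ) → ({l : Fin n // m ≤ (l : ℕ)} → T) → E := fun b y =>
      ∑ l : Fin n, if h : m ≤ (l : ℕ) then b l • ξ (y ⟨l, h⟩) else 0
    have hR : ∀ (b : Fin n → ℝ), Measurable (R b) := fun b =>
      Finset.measurable_fun_sum _ fun l _ => by
        by_cases h : m ≤ (l : ℕ)
        · simp only [h, dite_true]
          exact (hξ.comp (measurable_pi_apply _)).const_smul (b l)
        · simp only [h, dite_false]
          exact measurable_const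
    let res : (Fin n → T) → ({l : Fin n // m ≤ (l : ℕ)} → T) := fun s l => s l.1
    have hres : Measurable res := measurable_pi_lambda _ fun _ => measurable_pi_apply _
    have hsum0 : ∀ (s : Fin n → T), wsum ξ (tailWeights a m) s = R a (res s) := by
      intro s
      refine Finset.sum_congr rfl fun l _ => ?_
      by_cases h : m ≤ (l : ℕ) <;> simp [tailWeights, h, res]
    have hsum1 : ∀ (s : Fin n → T),
        wsum ξ (tailWeights a (m + 1)) s = R (tailWeights a (m + 1)) (res s) := by
      intro s
      refine Finset.sum_congr rfl fun l _ => ?_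
      by_cases h : m ≤ (l : ℕ)
      · simp [h, res]
      · have h' : ¬ (m + 1 ≤ (l : ℕ)) := by omega
        simp [h, tailWeights, h']
    let g : ({l : Fin n // m ≤ (l : ℕ)} → T) → ℝ := fun y =>
      ψ (R a y) - ψ (R (tailWeights a (m + 1)) y)
    have hg : Measurable g := (hψ.continuous.measurable.comp (hR _)).sub
      (hψ.continuous.measurable.comp (hR _))
    have hgs : ∀ y, |g y| ≤ |a mm| * c := by
      intro y
      have hy : R a y - R (tailWeights a (m + 1)) y = a mm • ξ (y ⟨mm, le_rfl⟩) := by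
        -- An arbitrary extension of `y` below `m`; these coordinates have weight zero in both sums.
        let s : Fin n → T := fun l => if h : m ≤ (l : ℕ) then y ⟨l, h⟩ else y ⟨mm, le_rfl⟩
        have hs : res s = y := by
          funext l
          simp [res, s, l.2]
        have := wsum_tailWeights_succ ξ a hm' s
        rw [hsum0, hsum1, hs] at this
        rw [this, add_sub_cancel_right]
        simp [s, mm]
      have h := hψ.dist_le_mul (R a y) (R (tailWeights a (m + 1)) y)
      rw [Real.dist_eq, NNReal.coe_one, one_mul, dist_eq_norm, hy, norm_smul,
        Real.norm_eq_abs] at h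
      exact h.trans (mul_le_mul_of_nonneg_left (hc _) (abs_nonneg _))
    have hmain := integral_sub_integral_le_of_abs_le
      (futureLaw κ (k + 1) n mm (Fin.take (k + 1) k.2 x))
      (futureLaw κ (k + 1) n mm (Fin.take (k + 1) k.2 z)) hg (by positivity) hgs
    have hcv : ∀ w : Fin (k + 1) → T, ∫ y, g y ∂(futureLaw κ (k + 1) n mm w)
        = ∫ s, ψ (wsum ξ (tailWeights a m) s) ∂(pathLaw κ (k + 1) n w)
          - ∫ s, ψ (wsum ξ (tailWeights a (m + 1)) s) ∂(pathLaw κ (k + 1) n w) := by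
      intro w
      rw [← integral_sub (integrable_lipschitz_wsum hξ hc _ hψ _)
        (integrable_lipschitz_wsum hξ hc _ hψ _)]
      have h1 : futureLaw κ (k + 1) n mm w = (pathLaw κ (k + 1) n w).map res := rfl
      rw [h1, integral_map hres.aemeasurable hg.aestronglyMeasurable]
      refine integral_congr_ae (.of_forall fun s => ?_)
      simp only [g, hsum0, hsum1]
    rw [hcv, hcv] at hmain
    have hG := tvDist_futureLaw_le_Gam κ hkmm x z hxz
    have hS : (∑ l : Fin n, if m ≤ (l : ℕ) then Gam κ n k l * |a l| else 0)
        = Gam κ n k mm * |a mm| + ∑ l : Fin n, if m + 1 ≤ (l : ℕ) then Gam κ n k l * |a l| else 0 := by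
      have h : ∀ l : Fin n, (if m ≤ (l : ℕ) then Gam κ n k l * |a l| else 0)
          = (if l = mm then Gam κ n k l * |a l| else 0)
            + (if m + 1 ≤ (l : ℕ) then Gam κ n k l * |a l| else 0) := by
        intro l
        rcases lt_trichotomy (l : ℕ) m with h | h | h
        · rw [if_neg (by omega), if_neg (by rw [Fin.ext_iff]; simp [mm]; omega),
            if_neg (by omega)]; simp
        · rw [if_pos (by omega), if_pos (by rw [Fin.ext_iff]; simpa using h),
            if_neg (by omega)]; simp
        · rw [if_pos (by omega), if_neg (by rw [Fin.ext_iff]; simp [mm]; omega),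
            if_pos (by omega)]; simp
      rw [Finset.sum_congr rfl fun l _ => h l, Finset.sum_add_distrib]
      simp
    rw [hS]
    have := mul_le_mul_of_nonneg_left hG (show 0 ≤ 2 * (|a mm| * c) by positivity)
    linarith

/-- The conditional expectation, given the points `0, …, k`, of a `1`-Lipschitz function of a
weighted sum of features oscillates by at most `2 c (Γ|a|)_k` in the point `k`. -/
lemma integral_lipschitz_sub_le [MeasurableSingletonClass T] {ξ : T → E} (hξ : Measurable ξ)
    {c : ℝ} (hc0 : 0 ≤ c) (hc : ∀ t, ‖ξ t‖ ≤ c) {n : ℕ} (a : Fin n → ℝ) {ψ : E → ℝ}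
    (hψ : LipschitzWith 1 ψ) (k : Fin n) (x : Fin k → T) (t t' : T) :
    ∫ s, ψ (wsum ξ a s) ∂(pathLaw κ (k + 1) n (Fin.snoc x t))
      - ∫ s, ψ (wsum ξ a s) ∂(pathLaw κ (k + 1) n (Fin.snoc x t'))
      ≤ 2 * c * (Gam κ n).mulVec (fun l => |a l|) k := by
  -- extend `x` to full sequences
  let ext : T → Fin n → T := fun r l => if h : (l : ℕ) < k then x ⟨l, h⟩ else if l = k then r else t
  have hext : ∀ r, Fin.take (k + 1) k.2 (ext r) = (Fin.snoc x r : Fin (k + 1) → T) := by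
    intro r
    funext l
    refine Fin.lastCases ?_ (fun l => ?_) l
    · rw [Fin.snoc_last]
      change (if h : (k : ℕ) < k then _ else if Fin.castLE k.2 (Fin.last k) = k then r else t) = r
      rw [dif_neg (lt_irrefl _)]
      exact if_pos (Fin.ext rfl)
    · rw [Fin.snoc_castSucc]
      exact dif_pos l.2
  have hdiff : ∀ l, l ≠ k → ext t l = ext t' l := by
    intro l hl
    simp [ext, hl]
  -- the weighted sum over the past
  let v : T → E := fun r => wsum ξ (fun l => if (l : ℕ) ≤ k then a l else 0) (ext r)
  have hv : ‖v t - v t'‖ ≤ |a k| * (2 * c) := by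
    have : v t - v t' = a k • (ξ t - ξ t') := by
      simp only [v, wsum, ← Finset.sum_sub_distrib]
      rw [Finset.sum_eq_single k]
      · simp [ext, smul_sub]
      · intro l _ hl
        rw [hdiff l hl, sub_self]
      · simp
    rw [this, norm_smul, Real.norm_eq_abs]
    refine mul_le_mul_of_nonneg_left ((norm_sub_le _ _).trans ?_) (abs_nonneg _)
    linarith [hc t, hc t']
  have hae : ∀ r, ∫ s, ψ (wsum ξ a s) ∂(pathLaw κ (k + 1) n (Fin.snoc x r))
      = ∫ s, ψ (v r + wsum ξ (tailWeights a (k + 1)) s) ∂(pathLaw κ (k + 1) n (Fin.snoc x r)) := by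
    intro r
    refine integral_congr_ae ?_
    filter_upwards [ae_take_eq κ (i := k + 1) (n := n) k.2 (Fin.snoc x r)] with s hs
    congr 1
    simp only [v, wsum, ← Finset.sum_add_distrib]
    refine Finset.sum_congr rfl fun l _ => ?_
    by_cases hl : (l : ℕ) ≤ k
    · have h1 : s l = ext r l := by
        have h2 := congrFun hs ⟨l, Nat.lt_succ_of_le hl⟩
        rw [← hext r] at h2
        exact h2
      have h3 : ¬ ((k : ℕ) + 1 ≤ l) := by omega
      simp [tailWeights, hl, h1, h3]
    · have h3 : (k : ℕ) + 1 ≤ l := by omega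
      simp [tailWeights, hl, h3]
  have hlip : ∀ r, LipschitzWith 1 fun u => ψ (v r + u) := fun r => by
    refine LipschitzWith.of_dist_le_mul fun u u' => ?_
    simpa using hψ.dist_le_mul (v r + u) (v r + u')
  -- The change from `t` to `t'` is made in two moves. Under the law given `t`, the past sum `v t`
  -- is replaced by `v t'` at cost `2c|a k|` (`h2`); this is the diagonal entry `Γ k k = 1`. Then,
  -- with `v t'` fixed, the law of the future changes, at the cost of the entries beyond the
  -- diagonal (`h1`).
  have h1 := integral_tail_sub_le κ hξ hc0 hc a (hlip t') (ext t) (ext t') hdiff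
    (m := k + 1) k.2 (Nat.lt_succ_self _)
  rw [hext, hext] at h1
  have h2 : ∫ s, ψ (v t + wsum ξ (tailWeights a (k + 1)) s)
        ∂(pathLaw κ (k + 1) n (Fin.snoc x t))
      ≤ |a k| * (2 * c) + ∫ s, ψ (v t' + wsum ξ (tailWeights a (k + 1)) s)
        ∂(pathLaw κ (k + 1) n (Fin.snoc x t)) := by
    have h3 : ∫ s, (|a k| * (2 * c) + ψ (v t' + wsum ξ (tailWeights a (k + 1)) s))
        ∂(pathLaw κ (k + 1) n (Fin.snoc x t))
        = |a k| * (2 * c) + ∫ s, ψ (v t' + wsum ξ (tailWeights a (k + 1)) s)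
        ∂(pathLaw κ (k + 1) n (Fin.snoc x t)) := by
      rw [integral_add (integrable_const _) (integrable_lipschitz_wsum hξ hc _ (hlip t') _)]
      simp
    rw [← h3]
    refine integral_mono (integrable_lipschitz_wsum hξ hc _ (hlip t) _)
      ((integrable_const _).add (integrable_lipschitz_wsum hξ hc _ (hlip t') _)) fun s => ?_
    have h4 := hψ.dist_le_mul (v t + wsum ξ (tailWeights a (k + 1)) s)
      (v t' + wsum ξ (tailWeights a (k + 1)) s)
    rw [Real.dist_eq, NNReal.coe_one, one_mul, dist_eq_norm, add_sub_add_right_eq_sub] at h4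
    simp only
    linarith [le_abs_self (ψ (v t + wsum ξ (tailWeights a (k + 1)) s)
      - ψ (v t' + wsum ξ (tailWeights a (k + 1)) s))]
  have h5 : (Gam κ n).mulVec (fun l => |a l|) k
      = |a k| + ∑ l : Fin n, if (k : ℕ) + 1 ≤ l then Gam κ n k l * |a l| else 0 := by
    have h : ∀ l : Fin n, Gam κ n k l * |a l| = (if l = k then |a l| else 0)
          + (if (k : ℕ) + 1 ≤ (l : ℕ) then Gam κ n k l * |a l| else 0) := by
      intro l
      rcases lt_trichotomy l k with h | h | h
      · rw [if_neg h.ne, if_neg (by omega)]; simp [Gam, h]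
      · rw [if_pos h, if_neg (by omega), h, Gam_self]; simp
      · rw [if_neg h.ne', if_pos (by omega)]; simp
    rw [Matrix.mulVec, dotProduct, Finset.sum_congr rfl fun l _ => h l, Finset.sum_add_distrib]
    simp
  rw [hae t, hae t', h5]
  linarith

end Oscillation

/-! ### Hoeffding's lemma and variance bounds from oscillations. -/

section MomentBounds

variable {Z : Type*} [MeasurableSpace Z]

/-- Hoeffding's lemma in terms of the oscillation. -/
lemma integral_exp_le_of_osc (ν : Measure Z) [IsProbabilityMeasure ν] {f : Z → ℝ}
    (hf : Measurable f) {r : ℝ} (hr : ∀ t t', f t - f t' ≤ r) (θ : ℝ) :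
    ∫ t, Real.exp (θ * f t) ∂ν ≤ Real.exp (θ * ∫ t, f t ∂ν + θ ^ 2 / 8 * r ^ 2) := by
  obtain ⟨t₀⟩ : Nonempty Z := nonempty_of_isProbabilityMeasure ν
  have hr0 : 0 ≤ r := by simpa using hr t₀ t₀
  have hbdd : BddBelow (Set.range f) := ⟨f t₀ - r, by
    rintro _ ⟨t, rfl⟩; linarith [hr t₀ t]⟩
  -- The values lie in an interval of length `r`, so the centred variable is sub-Gaussian with proxy
  -- `(r/2)²`; this gives `θ² r² / 8`.
  have hmem : ∀ t, f t ∈ Set.Icc (⨅ t, f t) ((⨅ t, f t) + r) := fun t => by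
    have : Nonempty Z := ⟨t₀⟩
    refine ⟨ciInf_le hbdd t, ?_⟩
    have : f t - r ≤ ⨅ t, f t := le_ciInf fun t' => by linarith [hr t t']
    linarith
  have h := (hasSubgaussianMGF_of_mem_Icc (μ := ν) hf.aemeasurable (.of_forall hmem)).mgf_le θ
  rw [mgf, add_sub_cancel_left] at h
  simp only [mul_sub, Real.exp_sub, integral_div] at h
  rw [div_le_iff₀ (Real.exp_pos _), ← Real.exp_add] at h
  refine h.trans (Real.exp_le_exp.2 (le_of_eq ?_))
  simp only [NNReal.coe_pow, NNReal.coe_div, coe_nnnorm, Real.norm_of_nonneg hr0, NNReal.coe_ofNat]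
  ring

/-- Nonnegativity of the variance. -/
lemma sq_integral_le (ν : Measure Z) [IsProbabilityMeasure ν] {f : Z → ℝ} (hf : Integrable f ν)
    (hf2 : Integrable (fun t => f t ^ 2) ν) : (∫ t, f t ∂ν) ^ 2 ≤ ∫ t, f t ^ 2 ∂ν := by
  set m := ∫ t, f t ∂ν with hm
  have h : 0 ≤ ∫ t, (f t - m) ^ 2 ∂ν := integral_nonneg fun t => sq_nonneg _
  have h2 : ∫ t, (f t - m) ^ 2 ∂ν = ∫ t, f t ^ 2 ∂ν - m ^ 2 := by
    have : ∀ t, (f t - m) ^ 2 = f t ^ 2 - 2 * m * f t + m ^ 2 := fun t => by ring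
    simp_rw [this]
    have h3 : Integrable (fun t => f t ^ 2 - 2 * m * f t) ν := hf2.sub (hf.const_mul _)
    rw [integral_add h3 (integrable_const _), integral_sub hf2 (hf.const_mul _), integral_const_mul, ← hm]
    simp
    ring
  linarith

variable {E : Type*} [NormedAddCommGroup E] [InnerProductSpace ℝ E] [CompleteSpace E]

/-- The mean squared distance of two independent copies. -/
lemma integral_integral_norm_sub_sq (ν : Measure Z) [IsProbabilityMeasure ν] {Y : Z → E}
    (hY : StronglyMeasurable Y) {C : ℝ} (hC : ∀ t, ‖Y t‖ ≤ C) :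
    ∫ t, ∫ t', ‖Y t - Y t'‖ ^ 2 ∂ν ∂ν = 2 * (∫ t, ‖Y t‖ ^ 2 ∂ν - ‖∫ t, Y t ∂ν‖ ^ 2) := by
  have hi : Integrable Y ν := Integrable.of_bound hY.aestronglyMeasurable C (.of_forall hC)
  have hi2 : Integrable (fun t => ‖Y t‖ ^ 2) ν :=
    Integrable.of_bound (hY.norm.pow 2).aestronglyMeasurable (C ^ 2) (.of_forall fun t => by
      rw [Real.norm_of_nonneg (by positivity)]
      exact pow_le_pow_left₀ (norm_nonneg _) (hC t) 2)
  have h1 : ∀ t, ∫ t', ‖Y t - Y t'‖ ^ 2 ∂ν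
      = ‖Y t‖ ^ 2 - 2 * inner ℝ (∫ t, Y t ∂ν) (Y t) + ∫ t', ‖Y t'‖ ^ 2 ∂ν := by
    intro t
    simp_rw [norm_sub_sq_real]
    have h3 : Integrable (fun t' => ‖Y t‖ ^ 2 - 2 * inner ℝ (Y t) (Y t')) ν :=
      (integrable_const _).sub ((hi.const_inner (Y t)).const_mul _)
    rw [integral_add h3 hi2,
      integral_sub (integrable_const _) ((hi.const_inner (Y t)).const_mul _), integral_const_mul,
      integral_inner hi, real_inner_comm]
    simp
  simp_rw [h1]
  have h3 : Integrable (fun t => ‖Y t‖ ^ 2 - 2 * inner ℝ (∫ t, Y t ∂ν) (Y t)) ν :=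
    hi2.sub ((hi.const_inner _).const_mul _)
  rw [integral_add h3 (integrable_const _),
    integral_sub hi2 ((hi.const_inner _).const_mul _), integral_const_mul, integral_inner hi,
    real_inner_self_eq_norm_sq]
  simp
  ring

/-- The variance is half the mean squared distance of two independent copies, and that distance
never exceeds `r`. -/
lemma integral_norm_sq_le_of_osc (ν : Measure Z) [IsProbabilityMeasure ν] {Y : Z → E}
    (hY : StronglyMeasurable Y) {C : ℝ} (hC : ∀ t, ‖Y t‖ ≤ C) {r : ℝ}
    (hr : ∀ t t', ‖Y t - Y t'‖ ≤ r) :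
    ∫ t, ‖Y t‖ ^ 2 ∂ν ≤ ‖∫ t, Y t ∂ν‖ ^ 2 + r ^ 2 / 2 := by
  have h := integral_integral_norm_sub_sq ν hY hC
  have hsq : ∀ t t', ‖Y t - Y t'‖ ^ 2 ≤ r ^ 2 := fun t t' =>
    pow_le_pow_left₀ (norm_nonneg _) (hr t t') 2
  have h2 : ∫ t, ∫ t', ‖Y t - Y t'‖ ^ 2 ∂ν ∂ν ≤ r ^ 2 := by
    have h3 : ∀ t, ∫ t', ‖Y t - Y t'‖ ^ 2 ∂ν ≤ r ^ 2 := fun t => by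
      refine (integral_mono_of_nonneg (.of_forall fun t' => by positivity)
        (integrable_const (r ^ 2)) (.of_forall (hsq t))).trans (le_of_eq ?_)
      simp
    refine (integral_mono_of_nonneg (.of_forall fun t =>
      integral_nonneg fun t' => by positivity)
      (integrable_const (r ^ 2)) (.of_forall h3)).trans (le_of_eq ?_)
    simp
  linarith

/-- Jensen in each variable reduces the mean distance to the mean squared distance of two copies,
which is twice the variance. The `V / 2` in the hypothesis cancels that factor. -/
lemma integral_integral_norm_sub_le (ν : Measure Z) [IsProbabilityMeasure ν] {Y : Z → E}
    (hY : StronglyMeasurable Y) {C : ℝ} (hC : ∀ t, ‖Y t‖ ≤ C) {V : ℝ}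
    (hV : ∫ t, ‖Y t‖ ^ 2 ∂ν ≤ ‖∫ t, Y t ∂ν‖ ^ 2 + V / 2) :
    ∫ t, ∫ t', ‖Y t - Y t'‖ ∂ν ∂ν ≤ Real.sqrt V := by
  refine Real.le_sqrt_of_sq_le ?_
  have hb : ∀ t t', ‖Y t - Y t'‖ ≤ 2 * C := fun t t' =>
    (norm_sub_le _ _).trans (by linarith [hC t, hC t'])
  have hm : StronglyMeasurable fun p : Z × Z => ‖Y p.1 - Y p.2‖ :=
    ((hY.comp_measurable measurable_fst).sub (hY.comp_measurable measurable_snd)).norm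
  have hi : ∀ t, Integrable (fun t' => ‖Y t - Y t'‖) ν := fun t =>
    Integrable.of_bound (hm.comp_measurable measurable_prodMk_left).aestronglyMeasurable (2 * C)
      (.of_forall fun t' => by rw [norm_norm]; exact hb t t')
  have hi2 : ∀ t, Integrable (fun t' => ‖Y t - Y t'‖ ^ 2) ν := fun t =>
    Integrable.of_bound ((hm.comp_measurable measurable_prodMk_left).pow 2).aestronglyMeasurable
      ((2 * C) ^ 2) (.of_forall fun t' => by
        rw [Real.norm_of_nonneg (by positivity)]
        exact pow_le_pow_left₀ (norm_nonneg _) (hb t t') 2)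
  have hg0 : ∀ t, 0 ≤ ∫ t', ‖Y t - Y t'‖ ∂ν := fun t => integral_nonneg fun t' => norm_nonneg _
  have hg1 : ∀ t, ∫ t', ‖Y t - Y t'‖ ∂ν ≤ 2 * C := fun t =>
    (integral_mono (hi t) (integrable_const _) (hb t)).trans (by simp)
  have hgm : StronglyMeasurable fun t => ∫ t', ‖Y t - Y t'‖ ∂ν := hm.integral_prod_right
  have hgi2 : Integrable (fun t => (∫ t', ‖Y t - Y t'‖ ∂ν) ^ 2) ν :=
    Integrable.of_bound (hgm.pow 2).aestronglyMeasurable ((2 * C) ^ 2) (.of_forall fun t => by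
      rw [Real.norm_of_nonneg (by positivity)]
      exact pow_le_pow_left₀ (hg0 t) (hg1 t) 2)
  have h1 := sq_integral_le ν (Integrable.of_bound hgm.aestronglyMeasurable (2 * C)
    (.of_forall fun t => by rw [Real.norm_of_nonneg (hg0 t)]; exact hg1 t)) hgi2
  have hm2 : StronglyMeasurable fun t => ∫ t', ‖Y t - Y t'‖ ^ 2 ∂ν := (hm.pow 2).integral_prod_right
  have h2 : ∫ t, (∫ t', ‖Y t - Y t'‖ ∂ν) ^ 2 ∂ν ≤ ∫ t, ∫ t', ‖Y t - Y t'‖ ^ 2 ∂ν ∂ν := by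
    refine integral_mono hgi2 (Integrable.of_bound hm2.aestronglyMeasurable ((2 * C) ^ 2)
      (.of_forall fun t => ?_)) fun t => sq_integral_le ν (hi t) (hi2 t)
    rw [Real.norm_of_nonneg (integral_nonneg fun t' => by positivity)]
    refine (integral_mono (hi2 t) (integrable_const ((2 * C) ^ 2)) fun t' =>
      pow_le_pow_left₀ (norm_nonneg _) (hb t t') 2).trans (by simp)
  rw [integral_integral_norm_sub_sq ν hY hC] at h2
  linarith

end MomentBounds

/-! ### Martingale bounds along the sequence. -/

section PathMoments

variable {T : Type*} [MeasurableSpace T]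

/-- The sum of the squared oscillation bounds of the points `k, …, n - 1`. -/
noncomputable def oscSq (κ : (i : ℕ) → Kernel (Fin i → T) T) (c : ℝ) {n : ℕ} (a : Fin n → ℝ) (k : ℕ) : ℝ :=
  ∑ l : Fin n, if k ≤ l then (2 * c * (Gam κ n).mulVec (fun m => |a m|) l) ^ 2 else 0

lemma oscSq_eq_add (κ : (i : ℕ) → Kernel (Fin i → T) T) (c : ℝ) {n : ℕ} (a : Fin n → ℝ) (k : Fin n) :
    oscSq κ c a k
      = oscSq κ c a (k + 1) + (2 * c * (Gam κ n).mulVec (fun m => |a m|) k) ^ 2 := by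
  have h : ∀ l : Fin n, (if (k : ℕ) ≤ l then
      (2 * c * (Gam κ n).mulVec (fun m => |a m|) l) ^ 2 else 0)
      = (if (k : ℕ) + 1 ≤ l then (2 * c * (Gam κ n).mulVec (fun m => |a m|) l) ^ 2 else 0)
        + (if l = k then (2 * c * (Gam κ n).mulVec (fun m => |a m|) l) ^ 2 else 0) := by
    intro l
    rcases lt_trichotomy l k with h | h | h
    · rw [if_neg (by omega), if_neg (by omega), if_neg h.ne]; simp
    · rw [if_pos (by omega), if_neg (by omega), if_pos h]; simp
    · rw [if_pos (by omega), if_pos (by omega), if_neg h.ne']; simp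
  unfold oscSq
  rw [Finset.sum_congr rfl fun l _ => h l, Finset.sum_add_distrib]
  simp

/-- Dropping the restriction `k ≤ l` leaves `4c² ‖Γ|a|‖²`, and `|a|` has the same Euclidean norm as
`a`. -/
lemma oscSq_le (κ : (i : ℕ) → Kernel (Fin i → T) T) (c : ℝ) {n : ℕ} (a : Fin n → ℝ) (k : ℕ) :
    oscSq κ c a k ≤ (2 * c * specNorm (Gam κ n)) ^ 2 * ∑ l, a l ^ 2 := by
  have h1 : oscSq κ c a k ≤ ∑ l, (2 * c * (Gam κ n).mulVec (fun m => |a m|) l) ^ 2 :=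
    Finset.sum_le_sum fun l _ => by
      split_ifs
      · exact le_rfl
      · exact sq_nonneg _
  have h2 := (LinearMap.toContinuousLinearMap (Matrix.toEuclideanLin (Gam κ n))).le_opNorm
    (WithLp.toLp 2 fun m => |a m|)
  have h3 : ∑ l, ((Gam κ n).mulVec (fun m => |a m|) l) ^ 2
      ≤ specNorm (Gam κ n) ^ 2 * ∑ l, a l ^ 2 := by
    have h4 := pow_le_pow_left₀ (norm_nonneg _) h2 2
    rw [mul_pow, EuclideanSpace.norm_sq_eq, EuclideanSpace.norm_sq_eq] at h4
    simpa [specNorm, Matrix.toEuclideanLin] using h4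
  calc oscSq κ c a k ≤ ∑ l, (2 * c * (Gam κ n).mulVec (fun m => |a m|) l) ^ 2 := h1
    _ = (2 * c) ^ 2 * ∑ l, ((Gam κ n).mulVec (fun m => |a m|) l) ^ 2 := by
        rw [Finset.mul_sum]; exact Finset.sum_congr rfl fun l _ => by ring
    _ ≤ (2 * c) ^ 2 * (specNorm (Gam κ n) ^ 2 * ∑ l, a l ^ 2) := by gcongr
    _ = _ := by ring

lemma stronglyMeasurable_integral_snoc (κ : (i : ℕ) → Kernel (Fin i → T) T)
    [∀ i, IsMarkovKernel (κ i)] {F : Type*} [NormedAddCommGroup F] [NormedSpace ℝ F]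
    {n k : ℕ} (x : Fin k → T) {f : (Fin n → T) → F} (hf : StronglyMeasurable f) :
    StronglyMeasurable fun t : T => ∫ s, f s ∂(pathLaw κ (k + 1) n (Fin.snoc x t)) :=
  hf.integral_kernel.comp_measurable (measurable_snoc_right x)

variable [MeasurableSingletonClass T]
  (κ : (i : ℕ) → Kernel (Fin i → T) T) [∀ i, IsMarkovKernel (κ i)]
  {E : Type*} [NormedAddCommGroup E] [InnerProductSpace ℝ E] [MeasurableSpace E] [BorelSpace E]
  [SecondCountableTopology E]

/-- Exponential moments of a `1`-Lipschitz function of a weighted sum of features. -/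
lemma integral_exp_pathLaw_le {ξ : T → E} (hξ : Measurable ξ) {c : ℝ} (hc0 : 0 ≤ c)
    (hc : ∀ t, ‖ξ t‖ ≤ c) {n : ℕ} (a : Fin n → ℝ) {ψ : E → ℝ} (hψ : LipschitzWith 1 ψ) (θ : ℝ)
    {k : ℕ} (hk : k ≤ n) (x : Fin k → T) :
    ∫ s, Real.exp (θ * ψ (wsum ξ a s)) ∂(pathLaw κ k n x)
      ≤ Real.exp (θ * ∫ s, ψ (wsum ξ a s) ∂(pathLaw κ k n x) + θ ^ 2 / 8 * oscSq κ c a k) := by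
  have hmeas := measurable_lipschitz_wsum hξ a hψ
  have hbd : ∀ s : Fin n → T, ‖Real.exp (θ * ψ (wsum ξ a s))‖
      ≤ Real.exp (|θ| * (|ψ 0| + ∑ k, |a k| * c)) := fun s => by
    rw [Real.norm_of_nonneg (Real.exp_pos _).le, Real.exp_le_exp]
    refine (le_abs_self _).trans ?_
    rw [abs_mul]
    exact mul_le_mul_of_nonneg_left (abs_lipschitz_wsum_le hc a hψ s) (abs_nonneg _)
  induction hd : n - k generalizing k with
  | zero =>
    obtain rfl : k = n := by omega
    have h0 : 0 ≤ oscSq κ c a k := Finset.sum_nonneg fun l _ => by split_ifs <;> positivity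
    rw [pathLaw_self, Kernel.id_apply, integral_dirac, integral_dirac]
    exact Real.exp_le_exp.2 (le_add_of_nonneg_right (by positivity))
  | succ d ih =>
    have hk' : k < n := by omega
    have hexp : StronglyMeasurable fun s : Fin n → T => Real.exp (θ * ψ (wsum ξ a s)) :=
      (hmeas.const_mul θ).exp.stronglyMeasurable
    -- The Doob martingale after point `k` is revealed. The induction hypothesis bounds the inner
    -- integral by `m t` and the later oscillations; Hoeffding's lemma then integrates out `t`.
    set m : T → ℝ := fun t => ∫ s, ψ (wsum ξ a s) ∂(pathLaw κ (k + 1) n (Fin.snoc x t)) with hm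
    have hmm : StronglyMeasurable m :=
      stronglyMeasurable_integral_snoc κ x hmeas.stronglyMeasurable
    have hosc := integral_lipschitz_sub_le κ hξ hc0 hc a hψ ⟨k, hk'⟩ x
    have hmb : ∀ t, |m t| ≤ |ψ 0| + ∑ k, |a k| * c := fun t => by
      have h := norm_integral_le_of_norm_le_const
        (μ := pathLaw κ (k + 1) n (Fin.snoc x t)) (f := fun s => ψ (wsum ξ a s))
        (.of_forall (abs_lipschitz_wsum_le hc a hψ))
      simpa [hm] using h
    rw [integral_pathLaw_step κ hk' x hexp hbd,
      integral_pathLaw_step κ hk' x hmeas.stronglyMeasurable (abs_lipschitz_wsum_le hc a hψ)]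
    calc ∫ t, ∫ s, Real.exp (θ * ψ (wsum ξ a s)) ∂(pathLaw κ (k + 1) n (Fin.snoc x t)) ∂(κ k x)
        ≤ ∫ t, Real.exp (θ * m t) * Real.exp (θ ^ 2 / 8 * oscSq κ c a (k + 1)) ∂(κ k x) := by
          refine integral_mono_of_nonneg (.of_forall fun t =>
            integral_nonneg fun s => (Real.exp_pos _).le) (Integrable.mul_const ?_ _)
            (.of_forall fun t => ?_)
          · refine Integrable.of_bound
              (hmm.measurable.const_mul θ).exp.aestronglyMeasurable
              (Real.exp (|θ| * (|ψ 0| + ∑ k, |a k| * c))) (.of_forall fun t => ?_)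
            rw [Real.norm_of_nonneg (Real.exp_pos _).le, Real.exp_le_exp]
            refine (le_abs_self _).trans ?_
            rw [abs_mul]
            exact mul_le_mul_of_nonneg_left (hmb t) (abs_nonneg _)
          · simp only
            rw [← Real.exp_add]
            exact ih hk' _ (by omega)
      _ ≤ Real.exp (θ * ∫ t, m t ∂(κ k x)
            + θ ^ 2 / 8 * (2 * c * (Gam κ n).mulVec (fun l => |a l|) ⟨k, hk'⟩) ^ 2)
            * Real.exp (θ ^ 2 / 8 * oscSq κ c a (k + 1)) := by
          rw [integral_mul_const]
          exact mul_le_mul_of_nonneg_right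
            (integral_exp_le_of_osc (κ k x) hmm.measurable hosc θ) (Real.exp_pos _).le
      _ = _ := by
          rw [← Real.exp_add]
          have := oscSq_eq_add κ c a ⟨k, hk'⟩
          simp only at this
          rw [this]
          congr 1
          ring

/-- The variance of a weighted sum of features. -/
lemma integral_norm_sq_pathLaw_le [CompleteSpace E] {ξ : T → E} (hξ : Measurable ξ) {c : ℝ}
    (hc0 : 0 ≤ c) (hc : ∀ t, ‖ξ t‖ ≤ c) {n : ℕ} (a : Fin n → ℝ) {k : ℕ} (hk : k ≤ n)
    (x : Fin k → T) :
    ∫ s, ‖wsum ξ a s‖ ^ 2 ∂(pathLaw κ k n x)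
      ≤ ‖∫ s, wsum ξ a s ∂(pathLaw κ k n x)‖ ^ 2 + oscSq κ c a k / 2 := by
  have hmeas := (measurable_wsum (E := E) hξ a).stronglyMeasurable
  have hbd : ∀ s : Fin n → T, ‖wsum ξ a s‖ ≤ ∑ k, |a k| * c := norm_wsum_le hc a
  have hC0 : 0 ≤ ∑ k, |a k| * c := Finset.sum_nonneg fun k _ => by positivity
  have hbd2 : ∀ s : Fin n → T, ‖‖wsum ξ a s‖ ^ 2‖ ≤ (∑ k, |a k| * c) ^ 2 := fun s => by
    rw [Real.norm_of_nonneg (by positivity)]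
    exact pow_le_pow_left₀ (norm_nonneg _) (hbd s) 2
  induction hd : n - k generalizing k with
  | zero =>
    obtain rfl : k = n := by omega
    have h0 : 0 ≤ oscSq κ c a k := Finset.sum_nonneg fun l _ => by split_ifs <;> positivity
    rw [pathLaw_self, Kernel.id_apply, integral_dirac, integral_dirac]
    linarith
  | succ d ih =>
    have hk' : k < n := by omega
    set m : T → E := fun t => ∫ s, wsum ξ a s ∂(pathLaw κ (k + 1) n (Fin.snoc x t)) with hm
    have hmm : StronglyMeasurable m := stronglyMeasurable_integral_snoc κ x hmeas
    have hmb : ∀ t, ‖m t‖ ≤ ∑ k, |a k| * c := fun t => by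
      refine (norm_integral_le_of_norm_le_const (.of_forall hbd)).trans ?_
      simp
    have hosc : ∀ t t', ‖m t - m t'‖ ≤ 2 * c * (Gam κ n).mulVec (fun l => |a l|) ⟨k, hk'⟩ := by
      intro t t'
      -- A vector of norm at most one that norms the difference. Pairing with it is a 1-Lipschitz
      -- scalar function, so the scalar oscillation bound also controls the vector-valued martingale
      -- step.
      obtain ⟨u, hu1, hu⟩ : ∃ u : E, ‖u‖ ≤ 1 ∧ inner ℝ u (m t - m t') = ‖m t - m t'‖ := by
        by_cases h0 : m t - m t' = 0
        · exact ⟨0, by simp, by simp [h0]⟩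
        · refine ⟨‖m t - m t'‖⁻¹ • (m t - m t'), ?_, ?_⟩
          · rw [norm_smul, norm_inv, norm_norm, inv_mul_cancel₀ (norm_ne_zero_iff.2 h0)]
          · rw [real_inner_smul_left, real_inner_self_eq_norm_sq, sq,
              inv_mul_cancel_left₀ (norm_ne_zero_iff.2 h0)]
      have hlip : LipschitzWith 1 fun v : E => inner ℝ u v := by
        refine LipschitzWith.of_dist_le_mul fun v w => ?_
        rw [Real.dist_eq, ← inner_sub_right, dist_eq_norm]
        refine (abs_real_inner_le_norm _ _).trans ?_
        exact mul_le_mul_of_nonneg_right hu1 (norm_nonneg _)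
      have h := integral_lipschitz_sub_le κ hξ hc0 hc a hlip ⟨k, hk'⟩ x t t'
      have hi : ∀ r, Integrable (wsum ξ a) (pathLaw κ (k + 1) n (Fin.snoc x r)) := fun r =>
        Integrable.of_bound hmeas.aestronglyMeasurable _ (.of_forall hbd)
      simp only at h
      rw [integral_inner (hi t), integral_inner (hi t'), ← inner_sub_right] at h
      rw [← hu]
      exact h
    rw [integral_pathLaw_step κ hk' x (F := fun s => ‖wsum ξ a s‖ ^ 2) (hmeas.norm.pow 2) hbd2,
      integral_pathLaw_step κ hk' x hmeas hbd]
    have hi2 : Integrable (fun t => ‖m t‖ ^ 2) (κ k x) :=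
      Integrable.of_bound (hmm.norm.pow 2).aestronglyMeasurable ((∑ k, |a k| * c) ^ 2)
        (.of_forall fun t => by
          rw [Real.norm_of_nonneg (by positivity)]
          exact pow_le_pow_left₀ (norm_nonneg _) (hmb t) 2)
    calc ∫ t, ∫ s, ‖wsum ξ a s‖ ^ 2 ∂(pathLaw κ (k + 1) n (Fin.snoc x t)) ∂(κ k x)
        ≤ ∫ t, (‖m t‖ ^ 2 + oscSq κ c a (k + 1) / 2) ∂(κ k x) :=
          integral_mono_of_nonneg (.of_forall fun t => integral_nonneg fun s => by positivity)
            (hi2.add (integrable_const _)) (.of_forall fun t => ih hk' _ (by omega))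
      _ = ∫ t, ‖m t‖ ^ 2 ∂(κ k x) + oscSq κ c a (k + 1) / 2 := by
          rw [integral_add hi2 (integrable_const _)]
          simp
      _ ≤ _ := by
          have h1 := integral_norm_sq_le_of_osc (κ k x) hmm hmb hosc
          have h2 := oscSq_eq_add κ c a ⟨k, hk'⟩
          linarith

/-- Exponential moments of the mean distance of a weighted sum of features to an independent copy. -/
lemma integral_exp_mean_dist_le [CompleteSpace E] {ξ : T → E} (hξ : Measurable ξ) {c : ℝ}
    (hc0 : 0 ≤ c) (hc : ∀ t, ‖ξ t‖ ≤ c) {n : ℕ} (a : Fin n → ℝ) {θ b : ℝ} (hθ : 0 ≤ θ)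
    (hb0 : 0 ≤ b) (hb : ∑ l, a l ^ 2 ≤ b ^ 2) {k : ℕ} (hk : k ≤ n) (x : Fin k → T) :
    ∫ s, Real.exp (θ * ∫ t, ‖wsum ξ a s - wsum ξ a t‖ ∂(pathLaw κ k n x)) ∂(pathLaw κ k n x)
      ≤ Real.exp (2 * (θ * (c * specNorm (Gam κ n) * b))
        + (θ * (c * specNorm (Gam κ n) * b)) ^ 2 / 2) := by
  have hg : 0 ≤ specNorm (Gam κ n) := norm_nonneg _
  have hmeas := (measurable_wsum (E := E) hξ a).stronglyMeasurable
  have hi : Integrable (wsum ξ a) (pathLaw κ k n x) :=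
    Integrable.of_bound hmeas.aestronglyMeasurable _ (.of_forall (norm_wsum_le hc a))
  -- With the copy `t` averaged out, the distance is a 1-Lipschitz function of the weighted sum, so
  -- the exponential moment bound applies to it.
  have hlip : LipschitzWith 1 fun v : E => ∫ t, ‖v - wsum ξ a t‖ ∂(pathLaw κ k n x) := by
    refine LipschitzWith.of_dist_le_mul fun v w => ?_
    have hiv : ∀ v : E, Integrable (fun t => ‖v - wsum ξ a t‖) (pathLaw κ k n x) := fun v =>
      ((integrable_const v).sub hi).norm
    rw [Real.dist_eq, ← integral_sub (hiv v) (hiv w), NNReal.coe_one, one_mul, dist_eq_norm]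
    have h := norm_integral_le_of_norm_le_const (μ := pathLaw κ k n x) (C := ‖v - w‖)
      (f := fun t => ‖v - wsum ξ a t‖ - ‖w - wsum ξ a t‖) (.of_forall fun t => ?_)
    · simpa using h
    · rw [Real.norm_eq_abs]
      refine (abs_norm_sub_norm_le _ _).trans (le_of_eq ?_)
      congr 1
      abel
  have hosc : oscSq κ c a k ≤ (2 * (c * specNorm (Gam κ n) * b)) ^ 2 :=
    (oscSq_le κ c a k).trans (by
      calc (2 * c * specNorm (Gam κ n)) ^ 2 * ∑ l, a l ^ 2
          ≤ (2 * c * specNorm (Gam κ n)) ^ 2 * b ^ 2 := by gcongr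
        _ = _ := by ring)
  -- The variance is at most `oscSq / 2`, so the mean distance of two copies is at most `√oscSq ≤ 2
  -- c ‖Γ‖ b`. This is the term `2θσ` of the exponent.
  have hmean : ∫ s, ∫ t, ‖wsum ξ a s - wsum ξ a t‖ ∂(pathLaw κ k n x) ∂(pathLaw κ k n x)
      ≤ 2 * (c * specNorm (Gam κ n) * b) := by
    refine (integral_integral_norm_sub_le (pathLaw κ k n x) hmeas (norm_wsum_le hc a)
      (integral_norm_sq_pathLaw_le κ hξ hc0 hc a hk x)).trans ?_
    exact Real.sqrt_le_iff.2 ⟨by positivity, hosc⟩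
  refine (integral_exp_pathLaw_le κ hξ hc0 hc a hlip θ hk x).trans (Real.exp_le_exp.2 ?_)
  have h1 := mul_le_mul_of_nonneg_left hmean hθ
  have h2 := mul_le_mul_of_nonneg_left hosc (show 0 ≤ θ ^ 2 / 8 by positivity)
  nlinarith [h1, h2]

end PathMoments

/-! ### Tail bound for the summed mean distances. -/

section Tail

variable {T : Type*} [MeasurableSpace T]

/-- A diagonal entry equal to `1` is a coordinate of the image of a unit vector. The bound makes the
scale `σ` in Chernoff's inequality positive. -/
lemma one_le_specNorm_Gam (κ : (i : ℕ) → Kernel (Fin i → T) T) {n : ℕ} (hn : 0 < n) :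
    1 ≤ specNorm (Gam κ n) := by
  let i : Fin n := ⟨0, hn⟩
  have h := (LinearMap.toContinuousLinearMap (Matrix.toEuclideanLin (Gam κ n))).le_opNorm
    (EuclideanSpace.single i 1)
  have h2 := PiLp.norm_apply_le (LinearMap.toContinuousLinearMap
    (Matrix.toEuclideanLin (Gam κ n)) (EuclideanSpace.single i 1)) i
  have h3 : (LinearMap.toContinuousLinearMap
    (Matrix.toEuclideanLin (Gam κ n)) (EuclideanSpace.single i 1)) i = 1 := by
    simp [Matrix.toEuclideanLin, Gam_self]
  rw [h3, norm_one] at h2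
  simpa [specNorm] using h2.trans h

variable [MeasurableSingletonClass T]
  (κ : (i : ℕ) → Kernel (Fin i → T) T) [∀ i, IsMarkovKernel (κ i)]
  {E : Type*} [NormedAddCommGroup E] [InnerProductSpace ℝ E] [MeasurableSpace E] [BorelSpace E]
  [SecondCountableTopology E]

/-- The mean distance of the weighted sum along `s` to the one along a sequence that has the same
first `j` points as `s` and is continued independently. -/
noncomputable def meanDist (κ : (i : ℕ) → Kernel (Fin i → T) T) (ξ : T → E) {n : ℕ}
    (a : Fin n → ℝ) (j : Fin n) (s : Fin n → T) : ℝ :=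
  ∫ t, ‖wsum ξ a s - wsum ξ a t‖ ∂(pathLaw κ j n (Fin.take j j.2.le s))

omit [MeasurableSingletonClass T] in
lemma measurable_meanDist {ξ : T → E} (hξ : Measurable ξ) {n : ℕ} (a : Fin n → ℝ) (j : Fin n) :
    Measurable (meanDist κ ξ a j) := by
  have hm : StronglyMeasurable fun p : (Fin n → T) × (Fin n → T) => ‖wsum ξ a p.1 - wsum ξ a p.2‖ :=
    (((measurable_wsum hξ a).comp measurable_fst).sub
      ((measurable_wsum hξ a).comp measurable_snd)).norm.stronglyMeasurable
  exact (hm.integral_kernel_prod_right'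
    (κ := (pathLaw κ j n).comap (Fin.take j j.2.le) (measurable_take _))).measurable

omit [MeasurableSpace E] [BorelSpace E] [SecondCountableTopology E] [MeasurableSingletonClass T] in
lemma meanDist_le {ξ : T → E} {c : ℝ} (hc : ∀ t, ‖ξ t‖ ≤ c) {n : ℕ} (a : Fin n → ℝ) (j : Fin n)
    (s : Fin n → T) : meanDist κ ξ a j s ≤ 2 * ∑ k, |a k| * c := by
  have h := norm_integral_le_of_norm_le_const (μ := pathLaw κ j n (Fin.take j j.2.le s))
    (C := 2 * ∑ k, |a k| * c) (f := fun t => ‖wsum ξ a s - wsum ξ a t‖) (.of_forall fun t => by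
      rw [norm_norm]
      refine (norm_sub_le _ _).trans ?_
      linarith [norm_wsum_le hc a s, norm_wsum_le hc a t])
  exact (le_abs_self _).trans (by simpa [meanDist] using h)

/-- Exponential moments of `meanDist`. -/
lemma integral_exp_meanDist_le [CompleteSpace E] {ξ : T → E} (hξ : Measurable ξ) {c : ℝ}
    (hc0 : 0 ≤ c) (hc : ∀ t, ‖ξ t‖ ≤ c) {n : ℕ} (a : Fin n → ℝ) {θ b : ℝ} (hθ : 0 ≤ θ)
    (hb0 : 0 ≤ b) (hb : ∑ l, a l ^ 2 ≤ b ^ 2) (j : Fin n) (x₀ : Fin 0 → T) :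
    ∫ s, Real.exp (θ * meanDist κ ξ a j s) ∂(pathLaw κ 0 n x₀)
      ≤ Real.exp (2 * (θ * (c * specNorm (Gam κ n) * b))
        + (θ * (c * specNorm (Gam κ n) * b)) ^ 2 / 2) := by
  have hm : Measurable fun s => Real.exp (θ * meanDist κ ξ a j s) :=
    ((measurable_meanDist κ hξ a j).const_mul θ).exp
  have hint : Integrable (fun s => Real.exp (θ * meanDist κ ξ a j s)) (pathLaw κ 0 n x₀) :=
    Integrable.of_bound hm.aestronglyMeasurable (Real.exp (θ * (2 * ∑ k, |a k| * c)))
      (.of_forall fun s => by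
        rw [Real.norm_of_nonneg (Real.exp_pos _).le, Real.exp_le_exp]
        exact mul_le_mul_of_nonneg_left (meanDist_le κ hc a j s) hθ)
  -- Conditioning on the first `j` points `x`: almost surely `s` begins with `x`, so `s` and its
  -- continuation become independent draws from the same law `pathLaw κ j n x`.
  rw [pathLaw_comp κ (Nat.zero_le j) j.2.le] at hint ⊢
  rw [Kernel.integral_comp hint]
  have hx : ∀ x : Fin j → T, ∫ s, Real.exp (θ * meanDist κ ξ a j s) ∂(pathLaw κ j n x)
      ≤ Real.exp (2 * (θ * (c * specNorm (Gam κ n) * b))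
        + (θ * (c * specNorm (Gam κ n) * b)) ^ 2 / 2) := by
    intro x
    refine (le_of_eq ?_).trans (integral_exp_mean_dist_le κ hξ hc0 hc a hθ hb0 hb j.2.le x)
    refine integral_congr_ae ?_
    filter_upwards [ae_take_eq κ j.2.le x] with s hs
    rw [meanDist, hs]
  refine (integral_mono_of_nonneg (.of_forall fun x =>
    integral_nonneg fun s => (Real.exp_pos _).le) (integrable_const _) (.of_forall hx)).trans ?_
  simp

/-- Exponential moments of the sum of the mean distances for a family of weights. -/
lemma integral_exp_sum_meanDist_le [CompleteSpace E] {ξ : T → E} (hξ : Measurable ξ) {c : ℝ}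
    (hc0 : 0 ≤ c) (hc : ∀ t, ‖ξ t‖ ≤ c) {n : ℕ} (a : Fin n → Fin n → ℝ) {θ b : ℝ} (hθ : 0 ≤ θ)
    (hb : ∑ j, Real.sqrt (∑ l, a j l ^ 2) ≤ b) (x₀ : Fin 0 → T) :
    ∫ s, Real.exp (θ * ∑ j, meanDist κ ξ (a j) j s) ∂(pathLaw κ 0 n x₀)
      ≤ Real.exp (2 * (θ * (c * specNorm (Gam κ n) * b))
        + (θ * (c * specNorm (Gam κ n) * b)) ^ 2 / 2) := by
  set r : Fin n → ℝ := fun j => Real.sqrt (∑ l, a j l ^ 2) with hr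
  have hr0 : ∀ j, 0 ≤ r j := fun j => Real.sqrt_nonneg _
  have hrsq : ∀ j, ∑ l, a j l ^ 2 = r j ^ 2 := fun j =>
    (Real.sq_sqrt (Finset.sum_nonneg fun l _ => sq_nonneg _)).symm
  set B := ∑ j, r j with hB
  have hB0 : 0 ≤ B := Finset.sum_nonneg fun j _ => hr0 j
  have hg : 0 ≤ specNorm (Gam κ n) := norm_nonneg _
  -- Nodes without later neighbours contribute nothing. They are treated apart because `B / r j`
  -- takes the default value `0` there.
  have hzero : ∀ j, r j = 0 → ∀ s, meanDist κ ξ (a j) j s = 0 := by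
    intro j hj s
    have h1 := hrsq j
    rw [hj, zero_pow two_ne_zero, Finset.sum_eq_zero_iff_of_nonneg fun l _ => sq_nonneg _] at h1
    have h2 : ∀ l, a j l = 0 := fun l => by simpa using h1 l (Finset.mem_univ _)
    simp [meanDist, wsum, h2]
  have hmono : Real.exp (2 * (θ * (c * specNorm (Gam κ n) * B))
        + (θ * (c * specNorm (Gam κ n) * B)) ^ 2 / 2)
      ≤ Real.exp (2 * (θ * (c * specNorm (Gam κ n) * b))
        + (θ * (c * specNorm (Gam κ n) * b)) ^ 2 / 2) := by
    rw [Real.exp_le_exp]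
    gcongr
  refine le_trans ?_ hmono
  rcases hB0.eq_or_lt with hB1 | hB1
  · have h1 : ∀ j, r j = 0 := fun j =>
      (Finset.sum_eq_zero_iff_of_nonneg fun j _ => hr0 j).1 hB1.symm j (Finset.mem_univ _)
    simp [hzero _ (h1 _), ← hB1]
  · have hsum : ∑ j, r j / B = 1 := by rw [← Finset.sum_div, div_self hB1.ne']
    -- Jensen with weights `r j / B`. The factor `B / r j` rescales node `j` so that every term has
    -- the same exponential moment bound, with `B` in place of `r j`; no independence between nodes
    -- is involved.
    have hpt : ∀ s, Real.exp (θ * ∑ j, meanDist κ ξ (a j) j s)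
        ≤ ∑ j, r j / B * Real.exp (θ * (B / r j) * meanDist κ ξ (a j) j s) := by
      intro s
      have h := convexOn_exp.map_sum_le (t := Finset.univ) (w := fun j => r j / B)
        (p := fun j => θ * (B / r j) * meanDist κ ξ (a j) j s)
        (fun j _ => div_nonneg (hr0 j) hB0) hsum (fun _ _ => Set.mem_univ _)
      simp only [smul_eq_mul] at h
      refine (le_of_eq ?_).trans h
      congr 1
      rw [Finset.mul_sum]
      refine Finset.sum_congr rfl fun j _ => ?_
      by_cases hj : r j = 0
      · simp [hzero j hj]
      · field_simp
    have hθj : ∀ j, 0 ≤ θ * (B / r j) := fun j => mul_nonneg hθ (div_nonneg hB0 (hr0 j))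
    have hint : ∀ j, Integrable (fun s => Real.exp (θ * (B / r j) * meanDist κ ξ (a j) j s))
        (pathLaw κ 0 n x₀) := fun j =>
      Integrable.of_bound ((measurable_meanDist κ hξ (a j) j).const_mul _).exp.aestronglyMeasurable
        (Real.exp (θ * (B / r j) * (2 * ∑ k, |a j k| * c)))
        (.of_forall fun s => by
          rw [Real.norm_of_nonneg (Real.exp_pos _).le, Real.exp_le_exp]
          exact mul_le_mul_of_nonneg_left (meanDist_le κ hc (a j) j s) (hθj j))
    calc ∫ s, Real.exp (θ * ∑ j, meanDist κ ξ (a j) j s) ∂(pathLaw κ 0 n x₀)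
        ≤ ∫ s, ∑ j, r j / B * Real.exp (θ * (B / r j) * meanDist κ ξ (a j) j s)
            ∂(pathLaw κ 0 n x₀) :=
          integral_mono_of_nonneg (.of_forall fun s => (Real.exp_pos _).le)
            (integrable_finsetSum _ fun j _ => (hint j).const_mul _) (.of_forall hpt)
      _ = ∑ j, r j / B * ∫ s, Real.exp (θ * (B / r j) * meanDist κ ξ (a j) j s)
            ∂(pathLaw κ 0 n x₀) := by
          rw [integral_finsetSum _ fun j _ => (hint j).const_mul _]
          exact Finset.sum_congr rfl fun j _ => integral_const_mul _ _
      _ ≤ ∑ j, r j / B * Real.exp (2 * (θ * (c * specNorm (Gam κ n) * B))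
            + (θ * (c * specNorm (Gam κ n) * B)) ^ 2 / 2) := by
          refine Finset.sum_le_sum fun j _ => ?_
          by_cases hj : r j = 0
          · simp [hj]
          · refine mul_le_mul_of_nonneg_left ?_ (div_nonneg (hr0 j) hB0)
            refine (integral_exp_meanDist_le κ hξ hc0 hc (a j) (hθj j) (hr0 j) (hrsq j).le j
              x₀).trans (le_of_eq ?_)
            have : θ * (B / r j) * (c * specNorm (Gam κ n) * r j)
                = θ * (c * specNorm (Gam κ n) * B) := by field_simp
            rw [this]
      _ = _ := by rw [← Finset.sum_mul, hsum, one_mul]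

/-- Tail bound for the sum of the mean distances. -/
lemma measure_sum_meanDist_ge_le [CompleteSpace E] {ξ : T → E} (hξ : Measurable ξ) {c : ℝ}
    (hc0 : 0 < c) (hc : ∀ t, ‖ξ t‖ ≤ c) {n : ℕ} (hn : 0 < n) (a : Fin n → Fin n → ℝ) {b : ℝ}
    (hb0 : 0 < b) (hb : ∑ j, Real.sqrt (∑ l, a j l ^ 2) ≤ b) {τ : ℝ} (hτ : 2 ≤ τ)
    (x₀ : Fin 0 → T) :
    (pathLaw κ 0 n x₀).real
        {s | τ * (c * specNorm (Gam κ n) * b) ≤ ∑ j, meanDist κ ξ (a j) j s}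
      ≤ Real.exp (-((τ - 2) ^ 2 / 2)) := by
  have hg : 0 < specNorm (Gam κ n) := zero_lt_one.trans_le (one_le_specNorm_Gam κ hn)
  set σ := c * specNorm (Gam κ n) * b with hσ
  have hσ0 : 0 < σ := by positivity
  -- `θ = (τ - 2)/σ` minimizes the Chernoff exponent `-θτσ + 2θσ + θ²σ²/2`.
  have hθ : 0 ≤ (τ - 2) / σ := div_nonneg (by linarith) hσ0.le
  have hm : Measurable fun s => ∑ j, meanDist κ ξ (a j) j s :=
    Finset.measurable_fun_sum _ fun j _ => measurable_meanDist κ hξ (a j) j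
  have hint : Integrable (fun s => Real.exp ((τ - 2) / σ * ∑ j, meanDist κ ξ (a j) j s))
      (pathLaw κ 0 n x₀) :=
    Integrable.of_bound (hm.const_mul _).exp.aestronglyMeasurable
      (Real.exp ((τ - 2) / σ * ∑ j, 2 * ∑ k, |a j k| * c)) (.of_forall fun s => by
        rw [Real.norm_of_nonneg (Real.exp_pos _).le, Real.exp_le_exp]
        exact mul_le_mul_of_nonneg_left
          (Finset.sum_le_sum fun j _ => meanDist_le κ hc (a j) j s) hθ)
  refine (measure_ge_le_exp_mul_mgf (τ * σ) hθ hint).trans ?_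
  have h := integral_exp_sum_meanDist_le κ hξ hc0.le hc a hθ hb x₀
  rw [← hσ, div_mul_cancel₀ _ hσ0.ne'] at h
  rw [mgf]
  refine (mul_le_mul_of_nonneg_left h (Real.exp_pos _).le).trans (le_of_eq ?_)
  rw [← Real.exp_add]
  congr 1
  field_simp
  ring

end Tail

/-! ### Lipschitz and measurability properties of the network; the auxiliary law. -/

section Network

variable {d : ℕ} {Y : Type*} [Fintype Y]

/-- The vector `v W`, for a row vector `v`. -/
noncomputable def rowMul (W : Matrix (Fin d) Y ℝ) (v : EuclideanSpace ℝ (Fin d)) :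
    EuclideanSpace ℝ Y :=
  WithLp.toLp 2 fun y => ∑ l, v l * W l y

/-- `specNorm` measures `W` acting on column vectors. The action on row vectors is the adjoint, and
`‖vW‖² = ⟨v, W (vW)⟩` transfers the bound. -/
lemma norm_rowMul_le [DecidableEq Y] (W : Matrix (Fin d) Y ℝ) (v : EuclideanSpace ℝ (Fin d)) :
    ‖rowMul W v‖ ≤ specNorm W * ‖v‖ := by
  set u := rowMul W v with hu
  have h1 : ‖u‖ ^ 2 = inner ℝ v (Matrix.toEuclideanLin W u) := by
    rw [EuclideanSpace.real_norm_sq_eq, PiLp.inner_apply]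
    simp only [Matrix.toEuclideanLin, hu, rowMul, sq, RCLike.inner_apply, conj_trivial,
      Matrix.mulVec, dotProduct, Finset.sum_mul, Matrix.toLpLin_apply]
    rw [Finset.sum_comm]
    exact Finset.sum_congr rfl fun l _ => Finset.sum_congr rfl fun y _ => by
      ring
  have h2 : ‖u‖ ^ 2 ≤ ‖v‖ * (specNorm W * ‖u‖) := by
    rw [h1]
    refine (real_inner_le_norm _ _).trans (mul_le_mul_of_nonneg_left ?_ (norm_nonneg _))
    exact (LinearMap.toContinuousLinearMap (Matrix.toEuclideanLin W)).le_opNorm u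
  rcases (norm_nonneg u).eq_or_lt with h | h
  · rw [← h]
    exact mul_nonneg (norm_nonneg _) (norm_nonneg _)
  · nlinarith

omit [Fintype Y] in
lemma rowMul_sub (W : Matrix (Fin d) Y ℝ) (v w : EuclideanSpace ℝ (Fin d)) :
    rowMul W (v - w) = rowMul W v - rowMul W w := by
  ext y
  simp [rowMul, sub_mul, Finset.sum_sub_distrib]

omit [Fintype Y] in
-- Aggregation commutes with multiplication by `W`: the output depends on the features only through
-- their weighted sum.
lemma output_eq (φ : ℝ → ℝ) (W : Matrix (Fin d) Y ℝ) {m : ℕ}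
    (x : Fin m → EuclideanSpace ℝ (Fin d)) (a : Fin m → ℝ) :
    output φ W x a = WithLp.toLp 2 fun y => φ (rowMul W (∑ k, a k • x k) y) := by
  unfold output rowMul
  congr 1
  funext y
  congr 1
  simp only [WithLp.ofLp_sum, WithLp.ofLp_smul, Finset.sum_apply, Pi.smul_apply, smul_eq_mul,
    Finset.sum_mul, Finset.mul_sum]
  rw [Finset.sum_comm]
  exact Finset.sum_congr rfl fun _ _ => Finset.sum_congr rfl fun _ _ => by ring

lemma norm_output_sub_le [DecidableEq Y] {φ : ℝ → ℝ} (hφ : LipschitzWith 1 φ)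
    (W : Matrix (Fin d) Y ℝ) {m : ℕ} (x x' : Fin m → EuclideanSpace ℝ (Fin d)) (a : Fin m → ℝ) :
    ‖output φ W x a - output φ W x' a‖
      ≤ specNorm W * ‖∑ k, a k • x k - ∑ k, a k • x' k‖ := by
  refine le_trans ?_ (norm_rowMul_le W _)
  rw [rowMul_sub, output_eq, output_eq, EuclideanSpace.norm_eq, EuclideanSpace.norm_eq]
  refine Real.sqrt_le_sqrt (Finset.sum_le_sum fun y _ => ?_)
  refine pow_le_pow_left₀ (norm_nonneg _) ?_ 2
  have h := hφ.dist_le_mul (rowMul W (∑ k, a k • x k) y) (rowMul W (∑ k, a k • x' k) y)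
  rwa [NNReal.coe_one, one_mul, dist_eq_norm, dist_eq_norm] at h

variable [MeasurableSpace Y] [MeasurableSingletonClass Y] {X : Set (EuclideanSpace ℝ (Fin d))}

/-- The label set is finite with measurable singletons, so joint measurability reduces to each fixed
label, where the loss is Lipschitz in the output. -/
lemma measurable_loss {φ : ℝ → ℝ} (hφ : LipschitzWith 1 φ) {ℓ : EuclideanSpace ℝ Y → Y → ℝ}
    {L : ℝ} (hℓL : ∀ u v y, |ℓ u y - ℓ v y| ≤ L * ‖v - u‖) (W : Matrix (Fin d) Y ℝ) (m : ℕ) :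
    Measurable fun p : ((Fin m → DataPt X Y) × (Fin m → ℝ)) × Y =>
      ℓ (output φ W (fun k => (p.1.1 k).1) p.1.2) p.2 := by
  have hℓ : Measurable fun q : EuclideanSpace ℝ Y × Y => ℓ q.1 q.2 := by
    refine measurable_from_prod_countable_left fun y => ?_
    have : LipschitzWith L.toNNReal fun u => ℓ u y := by
      refine LipschitzWith.of_dist_le_mul fun u v => ?_
      rw [Real.dist_eq, dist_comm, dist_eq_norm]
      exact (hℓL u v y).trans (mul_le_mul_of_nonneg_right (Real.le_coe_toNNReal L) (norm_nonneg _))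
    exact this.continuous.measurable
  have hout : Measurable fun p : ((Fin m → DataPt X Y) × (Fin m → ℝ)) × Y =>
      output φ W (fun k => (p.1.1 k).1) p.1.2 := by
    unfold output
    refine (WithLp.measurable_toLp 2 _).comp (measurable_pi_lambda _ fun y => ?_)
    refine hφ.continuous.measurable.comp (Finset.measurable_fun_sum _ fun k _ => ?_)
    refine Measurable.mul ((measurable_pi_apply k).comp (measurable_snd.comp measurable_fst)) ?_
    refine Finset.measurable_fun_sum _ fun l _ => Measurable.mul_const ?_ _
    have h1 : Measurable fun p : ((Fin m → DataPt X Y) × (Fin m → ℝ)) × Y =>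
        ((p.1.1 k).1 : EuclideanSpace ℝ (Fin d)) :=
      measurable_subtype_coe.comp (measurable_fst.comp
        ((measurable_pi_apply k).comp (measurable_fst.comp measurable_fst)))
    exact (EuclideanSpace.proj (𝕜 := ℝ) l).continuous.measurable.comp h1
  exact hℓ.comp (hout.prodMk measurable_snd)

/-- Feature of a data point. -/
def feature (p : DataPt X Y) : EuclideanSpace ℝ (Fin d) := p.1

omit [Fintype Y] [MeasurableSingletonClass Y] in
lemma measurable_feature : Measurable (feature : DataPt X Y → EuclideanSpace ℝ (Fin d)) :=
  measurable_subtype_coe.comp measurable_fst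

/-- The coefficients of node `j` on the later nodes. -/
noncomputable def laterCoeff {n : ℕ} (g : SimpleGraph (Fin n)) (j l : Fin n) : ℝ :=
  if j < l then normAdjSelf g j l else 0

omit [Fintype Y] [MeasurableSpace Y] [MeasurableSingletonClass Y] in
-- The reason for the shape of `auxCoeff`: a new node with these coefficients aggregates exactly as
-- node `i` would if its own point were replaced by `x`.
lemma sum_auxCoeff {n : ℕ} (g : SimpleGraph (Fin n)) (i : Fin n) (s : Fin n → DataPt X Y)
    (x : DataPt X Y) :
    ∑ k, auxCoeff g i k • (((Fin.snoc s x : Fin (n + 1) → DataPt X Y) k).1 :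
      EuclideanSpace ℝ (Fin d))
      = ∑ k, normAdjSelf g i k • ((Function.update s i x k).1 : EuclideanSpace ℝ (Fin d)) := by
  rw [Fin.sum_univ_castSucc]
  simp only [auxCoeff, Fin.snoc_castSucc, Fin.snoc_last]
  rw [← Finset.add_sum_erase _ _ (Finset.mem_univ i), ← Finset.add_sum_erase Finset.univ
    (fun k => normAdjSelf g i k • ((Function.update s i x k).1 : EuclideanSpace ℝ (Fin d)))
    (Finset.mem_univ i)]
  simp only [Function.update_self, zero_smul, zero_add]
  rw [add_comm]
  congr 1
  refine Finset.sum_congr rfl fun k hk => ?_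
  rw [Function.update_of_ne (Finset.ne_of_mem_erase hk),
    Function.update_of_ne (Finset.ne_of_mem_erase hk)]

instance {n : ℕ} [NeZero n] (g : SimpleGraph (Fin n)) : IsProbabilityMeasure (auxLaw g) := by
  constructor
  simp [auxLaw, ENNReal.mul_inv_cancel (Nat.cast_ne_zero.2 (NeZero.ne n))]

lemma integral_auxLaw {n : ℕ} (g : SimpleGraph (Fin n)) (f : (Fin (n + 1) → ℝ) → ℝ) :
    ∫ a, f a ∂(auxLaw g) = (1 / n) * ∑ i, f (auxCoeff g i) := by
  unfold auxLaw
  rw [integral_finsetSum_measure]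
  · rw [Finset.mul_sum]
    refine Finset.sum_congr rfl fun i _ => ?_
    rw [integral_smul_measure, integral_dirac]
    simp
  · intro i _
    have : Integrable f (Measure.dirac (auxCoeff g i)) := integrable_dirac (by simp)
    refine this.smul_measure ?_
    have := i.pos
    simp
    omega

end Network

/-! ### Deterministic bound on the generalization gap. -/

section Gap

variable {d : ℕ} {Y : Type*} [Fintype Y] [DecidableEq Y] [MeasurableSpace Y]
  [MeasurableSingletonClass Y] {X : Set (EuclideanSpace ℝ (Fin d))}

/-- Replacing the later points of a sequence by independent ones changes the loss at node `i` by at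
most `L ‖W‖` times the mean distance of the aggregated features. -/
lemma integral_loss_update_sub_le {φ : ℝ → ℝ} (hφ : LipschitzWith 1 φ)
    {ℓ : EuclideanSpace ℝ Y → Y → ℝ} {cx cw L M : ℝ} (hL : 0 ≤ L)
    (hX : ∀ x ∈ X, ‖x‖ ≤ cx) (hℓL : ∀ u v y, |ℓ u y - ℓ v y| ≤ L * ‖v - u‖)
    (hℓ0 : ∀ u y, 0 ≤ ℓ u y) (hℓM : ∀ u y, ℓ u y ≤ M) {n : ℕ}
    (κ : (i : ℕ) → Kernel (Fin i → DataPt X Y) (DataPt X Y)) [∀ i, IsMarkovKernel (κ i)]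
    {W : Matrix (Fin d) Y ℝ} (hW : specNorm W ≤ cw) (s : Fin n → DataPt X Y)
    (g : SimpleGraph (Fin n)) (i : Fin n) :
    ∫ x, ℓ (output φ W (fun k => (Function.update s i x k).1) (normAdjSelf g i)) x.2
        ∂(κ i (Fin.take i i.2.le s))
      - ∫ t, ℓ (output φ W (fun k => (t k).1) (normAdjSelf g i)) (t i).2
          ∂(pathLaw κ i n (Fin.take i i.2.le s))
      ≤ L * cw * meanDist κ feature (laterCoeff g i) i s := by
  set P := pathLaw κ i n (Fin.take i i.2.le s) with hP
  have hloss := measurable_loss (X := X) hφ hℓL W n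
  have hm1 : Measurable fun x : DataPt X Y =>
      ℓ (output φ W (fun k => (Function.update s i x k).1) (normAdjSelf g i)) x.2 :=
    hloss.comp (((measurable_update s).prodMk measurable_const).prodMk measurable_snd)
  have hm2 : Measurable fun t : Fin n → DataPt X Y =>
      ℓ (output φ W (fun k => (Function.update s i (t i) k).1) (normAdjSelf g i)) (t i).2 :=
    hm1.comp (measurable_pi_apply i)
  have hm3 : Measurable fun t : Fin n → DataPt X Y =>
      ℓ (output φ W (fun k => (t k).1) (normAdjSelf g i)) (t i).2 :=
    hloss.comp ((measurable_id.prodMk measurable_const).prodMk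
      (measurable_snd.comp (measurable_pi_apply i)))
  have hb : ∀ u y, ‖ℓ u y‖ ≤ M := fun u y => by
    rw [Real.norm_of_nonneg (hℓ0 u y)]; exact hℓM u y
  have hcx : ∀ t : DataPt X Y, ‖feature t‖ ≤ cx := fun t => hX _ t.1.2
  have hd : Integrable (fun t => ‖wsum feature (laterCoeff g i) s - wsum feature (laterCoeff g i) t‖)
      P := by
    refine Integrable.norm ((integrable_const _).sub (Integrable.of_bound
      (measurable_wsum measurable_feature _).aestronglyMeasurable _
      (.of_forall (norm_wsum_le hcx _))))
  -- Coupling: coordinate `i` of the continuation has law `κ i`, so both losses become functions of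
  -- the same random `t` and share the point and the label at node `i`.
  have h1 : ∫ x, ℓ (output φ W (fun k => (Function.update s i x k).1) (normAdjSelf g i)) x.2
        ∂(κ i (Fin.take i i.2.le s))
      = ∫ t, ℓ (output φ W (fun k => (Function.update s i (t i) k).1) (normAdjSelf g i)) (t i).2
          ∂P := by
    rw [← pathLaw_map_eval, integral_map (measurable_pi_apply i).aemeasurable
      hm1.aestronglyMeasurable]
  rw [h1, ← integral_sub (Integrable.of_bound hm2.aestronglyMeasurable M (.of_forall fun t => hb _ _))
    (Integrable.of_bound hm3.aestronglyMeasurable M (.of_forall fun t => hb _ _)), meanDist,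
    ← integral_const_mul]
  refine integral_mono_ae
    ((Integrable.of_bound hm2.aestronglyMeasurable M (.of_forall fun t => hb _ _)).sub
      (Integrable.of_bound hm3.aestronglyMeasurable M (.of_forall fun t => hb _ _)))
    (hd.const_mul _) ?_
  filter_upwards [ae_take_eq κ i.2.le (Fin.take i i.2.le s)] with t ht
  refine (le_abs_self _).trans ((hℓL _ _ _).trans ?_)
  rw [mul_assoc]
  refine mul_le_mul_of_nonneg_left ?_ hL
  rw [norm_sub_rev]
  refine (norm_output_sub_le hφ W _ _ _).trans (mul_le_mul hW (le_of_eq ?_) (norm_nonneg _)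
    ((norm_nonneg _).trans hW))
  congr 1
  simp only [wsum, ← Finset.sum_sub_distrib, ← smul_sub]
  refine Finset.sum_congr rfl fun k _ => ?_
  -- Before `i` both sequences follow `s`, and at `i` both carry `t i`. Only `s k` against `t k` for
  -- `k > i` remains, which is what `laterCoeff` selects.
  rcases lt_trichotomy k i with hk | hk | hk
  · have h2 : t k = s k := congrFun ht ⟨k, hk⟩
    rw [Function.update_of_ne hk.ne, h2]
    simp
  · subst hk
    simp [laterCoeff]
  · rw [Function.update_of_ne hk.ne']
    simp [laterCoeff, hk, feature]

/-- Deterministic bound on the generalization gap, uniform in the parameter. -/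
lemma gapTwo_le {φ : ℝ → ℝ} (hφ : LipschitzWith 1 φ)
    {ℓ : EuclideanSpace ℝ Y → Y → ℝ} {cx cw L M : ℝ} (hL : 0 ≤ L) (hM : 0 ≤ M)
    (hX : ∀ x ∈ X, ‖x‖ ≤ cx) (hℓL : ∀ u v y, |ℓ u y - ℓ v y| ≤ L * ‖v - u‖)
    (hℓ0 : ∀ u y, 0 ≤ ℓ u y) (hℓM : ∀ u y, ℓ u y ≤ M) {n : ℕ} [NeZero n]
    (κ : (i : ℕ) → Kernel (Fin i → DataPt X Y) (DataPt X Y)) [∀ i, IsMarkovKernel (κ i)]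
    (β : Kernel (SimpleGraph (Fin n)) (Fin (n + 1) → ℝ)) [IsMarkovKernel β]
    (ρ : Kernel ((Fin n → DataPt X Y) × SimpleGraph (Fin n)) (DataPt X Y × (Fin (n + 1) → ℝ)))
    (s : Fin n → DataPt X Y) (g : SimpleGraph (Fin n)) (hρ : ρ (s, g) = (κ n s).prod (β g))
    {W : Matrix (Fin d) Y ℝ} (hW : specNorm W ≤ cw) :
    gapTwo φ ℓ κ ρ W s g
      ≤ (M / n) * ∑ i : Fin n, tvDist (κ n s) (κ i (Fin.take i i.2.le s))
        + M * tvDist (β g) (auxLaw g)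
        + L * cw / n * ∑ i : Fin n, meanDist κ feature (laterCoeff g i) i s := by
  have hloss := measurable_loss (X := X) hφ hℓL W (n + 1)
  have hlossn := measurable_loss (X := X) hφ hℓL W n
  have hb : ∀ u y, ‖ℓ u y‖ ≤ M := fun u y => by
    rw [Real.norm_of_nonneg (hℓ0 u y)]; exact hℓM u y
  let F : DataPt X Y × (Fin (n + 1) → ℝ) → ℝ := fun p =>
    ℓ (output φ W (fun k => ((Fin.snoc s p.1 : Fin (n + 1) → DataPt X Y) k).1) p.2) p.1.2
  have hF : Measurable F :=
    hloss.comp ((((measurable_snoc_right s).comp measurable_fst).prodMk measurable_snd).prodMk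
      (measurable_snd.comp measurable_fst))
  have hFi : Integrable F ((κ n s).prod (β g)) :=
    Integrable.of_bound hF.aestronglyMeasurable M (.of_forall fun p => hb _ _)
  let H : Fin n → DataPt X Y → ℝ := fun i x =>
    ℓ (output φ W (fun k => (Function.update s i x k).1) (normAdjSelf g i)) x.2
  have hH : ∀ i, Measurable (H i) := fun i =>
    hlossn.comp (((measurable_update s).prodMk measurable_const).prodMk measurable_snd)
  have hHi : ∀ i, Integrable (H i) (κ n s) := fun i =>
    Integrable.of_bound (hH i).aestronglyMeasurable M (.of_forall fun p => hb _ _)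
  have hFH : ∀ i x, F (x, auxCoeff g i) = H i x := by
    intro i x
    simp only [F, H]
    rw [output_eq, output_eq, sum_auxCoeff]
  have h1 : ∀ x, ∫ a, F (x, a) ∂(β g) ≤ M * tvDist (β g) (auxLaw g) + (1 / n) * ∑ i, H i x := by
    intro x
    have h := integral_sub_integral_le_tvDist (β g) (auxLaw g)
      (hF.comp (measurable_prodMk_left (x := x))) hM (fun a => hℓ0 _ _) (fun a => hℓM _ _)
    have h2 := integral_auxLaw g (F ∘ Prod.mk x)
    simp only [Function.comp_apply, hFH] at h h2
    linarith
  have h2 : risk φ ℓ ρ W s g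
      ≤ M * tvDist (β g) (auxLaw g) + (1 / n) * ∑ i, ∫ x, H i x ∂(κ n s) := by
    have h3 : risk φ ℓ ρ W s g = ∫ x, ∫ a, F (x, a) ∂(β g) ∂(κ n s) := by
      rw [risk, hρ, integral_prod _ hFi]
    rw [h3]
    have hint : Integrable (fun x => ∑ i, H i x) (κ n s) := integrable_finsetSum _ fun i _ => hHi i
    refine (integral_mono hFi.integral_prod_left
      ((integrable_const _).add (hint.const_mul _)) h1).trans (le_of_eq ?_)
    rw [integral_add' (integrable_const _) (hint.const_mul _),
      integral_const_mul (1 / (n : ℝ)),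
      integral_finsetSum _ fun i _ => hHi i]
    simp
  -- First the new point is redrawn from `κ i`, at total variation cost; then the observed later
  -- points are replaced by a continuation, at the cost of `meanDist`.
  have h4 : ∀ i : Fin n, ∫ x, H i x ∂(κ n s) ≤ M * tvDist (κ n s) (κ i (Fin.take i i.2.le s))
      + L * cw * meanDist κ feature (laterCoeff g i) i s
      + ∫ t, ℓ (output φ W (fun k => (t k).1) (normAdjSelf g i)) (t i).2
          ∂(pathLaw κ i n (Fin.take i i.2.le s)) := by
    intro i
    have h5 := integral_sub_integral_le_tvDist (κ n s) (κ i (Fin.take i i.2.le s)) (hH i) hM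
      (fun a => hℓ0 _ _) (fun a => hℓM _ _)
    have h6 := integral_loss_update_sub_le hφ hL hX hℓL hℓ0 hℓM κ hW s g i
    linarith
  have h7 := mul_le_mul_of_nonneg_left (Finset.sum_le_sum fun i (_ : i ∈ Finset.univ) => h4 i)
    (show (0 : ℝ) ≤ 1 / n by positivity)
  rw [Finset.sum_add_distrib, Finset.sum_add_distrib, ← Finset.mul_sum, ← Finset.mul_sum] at h7
  have h8 : (1 / n : ℝ) * (M * ∑ i : Fin n, tvDist (κ n s) (κ i (Fin.take i i.2.le s))
      + L * cw * ∑ i, meanDist κ feature (laterCoeff g i) i s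
      + ∑ i : Fin n, ∫ t, ℓ (output φ W (fun k => (t k).1) (normAdjSelf g i)) (t i).2
          ∂(pathLaw κ i n (Fin.take i i.2.le s)))
      = (M / n) * ∑ i : Fin n, tvDist (κ n s) (κ i (Fin.take i i.2.le s))
        + L * cw / n * ∑ i : Fin n, meanDist κ feature (laterCoeff g i) i s
        + (1 / n) * ∑ i : Fin n, ∫ t, ℓ (output φ W (fun k => (t k).1) (normAdjSelf g i)) (t i).2
          ∂(pathLaw κ i n (Fin.take i i.2.le s)) := by ring
  rw [h8] at h7
  unfold gapTwo
  linarith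

end Gap

/-! ### Size of the normalized adjacency coefficients. -/

section Coefficients

lemma adj_nonneg {n : ℕ} (g : SimpleGraph (Fin n)) (i j : Fin n) : 0 ≤ adj g i j := by
  unfold adj; split_ifs <;> norm_num

lemma adj_comm {n : ℕ} (g : SimpleGraph (Fin n)) (i j : Fin n) : adj g i j = adj g j i := by
  by_cases h : g.Adj i j
  · simp [adj, h, h.symm]
  · simp [adj, h, mt SimpleGraph.Adj.symm h]

lemma deg_le {n : ℕ} (g : SimpleGraph (Fin n)) (i : Fin n) : deg g i ≤ n - 1 := by
  have h : deg g i = ∑ j ∈ Finset.univ.erase i, adj g i j := by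
    rw [deg, ← Finset.add_sum_erase _ _ (Finset.mem_univ i)]
    simp [adj]
  rw [h]
  refine (Finset.sum_le_card_nsmul _ _ 1 fun j _ => ?_).trans (le_of_eq ?_)
  · unfold adj; split_ifs <;> norm_num
  · rw [Finset.card_erase_of_mem (Finset.mem_univ i), Finset.card_univ, Fintype.card_fin,
      nsmul_eq_mul, mul_one, Nat.cast_sub i.pos]
    simp

lemma one_le_deg {n : ℕ} (g : SimpleGraph (Fin n)) {i j : Fin n} (h : g.Adj i j) :
    1 ≤ deg g i := by
  have h1 : adj g i j = 1 := by simp [adj, h]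
  rw [← h1]
  exact Finset.single_le_sum (f := fun j => adj g i j) (fun j _ => adj_nonneg g i j)
    (Finset.mem_univ j)

lemma normAdj_comm {n : ℕ} (g : SimpleGraph (Fin n)) (i j : Fin n) :
    normAdj g i j = normAdj g j i := by
  unfold normAdj
  rw [adj_comm g i j, mul_comm (Real.sqrt _)]
  simp only [eq_comm]

/-- The entries with self-connections are smaller than those without. -/
lemma normAdjSelf_sq_le {n : ℕ} (g : SimpleGraph (Fin n)) {i j : Fin n} (hij : j ≠ i) :
    normAdjSelf g i j ^ 2 ≤ ((n - 1) / n : ℝ) ^ 2 * normAdj g i j ^ 2 := by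
  unfold normAdjSelf normAdj
  rw [if_neg hij, if_neg hij]
  by_cases h : g.Adj i j
  · have hi := one_le_deg g h
    have hj := one_le_deg g h.symm
    have hi' := deg_le g i
    have hj' := deg_le g j
    have hn : (1 : ℝ) ≤ n - 1 := hi.trans hi'
    have h1 : adj g i j = 1 := by simp [adj, h]
    -- `D / (D + 1)` increases in `D`, and a simple graph has degrees at most `n - 1`.
    have hf : ∀ D : ℝ, 1 ≤ D → D ≤ n - 1 → 1 / (D + 1) ≤ ((n - 1) / n : ℝ) * (1 / D) := by
      intro D h1 h2
      rw [div_mul_div_comm, mul_one, div_le_div_iff₀ (by linarith) (by nlinarith)]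
      nlinarith
    have e : ∀ a b : ℝ, 0 ≤ a → 0 ≤ b →
        (1 / (Real.sqrt a * Real.sqrt b)) ^ 2 = (1 / a) * (1 / b) := by
      intro a b ha hb
      rw [div_pow, mul_pow, Real.sq_sqrt ha, Real.sq_sqrt hb]
      field_simp
    rw [h1, e _ _ (by linarith) (by linarith), e _ _ (by linarith) (by linarith)]
    calc (1 / (deg g i + 1)) * (1 / (deg g j + 1))
        ≤ (((n - 1) / n : ℝ) * (1 / deg g i)) * (((n - 1) / n : ℝ) * (1 / deg g j)) := by
          refine mul_le_mul (hf _ hi hi') (hf _ hj hj') (by positivity) ?_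
          have : (0 : ℝ) ≤ n - 1 := by linarith
          positivity
      _ = _ := by ring
  · have h1 : adj g i j = 0 := by simp [adj, h]
    simp [h1]

/-- By symmetry, the entries above the diagonal carry at most half of the squared Frobenius norm. -/
lemma sum_laterCoeff_sq_le {n : ℕ} (g : SimpleGraph (Fin n)) {ca : ℝ}
    (h : frobNorm (normAdj g) ≤ ca) :
    ∑ j, ∑ l, laterCoeff g j l ^ 2 ≤ ((n - 1) / n : ℝ) ^ 2 * (ca ^ 2 / 2) := by
  have h0 : ∑ i, ∑ j, normAdj g i j ^ 2 ≤ ca ^ 2 := by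
    rw [← Real.sq_sqrt (show 0 ≤ ∑ i, ∑ j, normAdj g i j ^ 2 by positivity)]
    exact pow_le_pow_left₀ (Real.sqrt_nonneg _) h 2
  have h1 : ∑ j, ∑ l, (if j < l then normAdj g j l ^ 2 else 0)
      + ∑ j, ∑ l, (if j < l then normAdj g j l ^ 2 else 0)
      ≤ ∑ i, ∑ j, normAdj g i j ^ 2 := by
    nth_rewrite 2 [Finset.sum_comm]
    rw [← Finset.sum_add_distrib]
    refine Finset.sum_le_sum fun j _ => ?_
    rw [← Finset.sum_add_distrib]
    refine Finset.sum_le_sum fun l _ => ?_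
    rw [normAdj_comm g l j]
    rcases lt_trichotomy j l with h | h | h
    · simp [h, h.not_gt]
    · simp [h]; positivity
    · simp [h, h.not_gt]
  have h2 : ∑ j, ∑ l, laterCoeff g j l ^ 2
      ≤ ((n - 1) / n : ℝ) ^ 2 * ∑ j, ∑ l, (if j < l then normAdj g j l ^ 2 else 0) := by
    rw [Finset.mul_sum]
    refine Finset.sum_le_sum fun j _ => ?_
    rw [Finset.mul_sum]
    refine Finset.sum_le_sum fun l _ => ?_
    unfold laterCoeff
    split_ifs with hjl
    · exact normAdjSelf_sq_le g hjl.ne'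
    · simp
  refine h2.trans (mul_le_mul_of_nonneg_left ?_ (sq_nonneg _))
  linarith

/-- Cauchy–Schwarz over the `n` nodes, which turns the sum of row norms into the Frobenius bound. -/
lemma sum_sqrt_laterCoeff_le {n : ℕ} (hn : 0 < n) (g : SimpleGraph (Fin n)) {ca : ℝ} (hca : 0 ≤ ca)
    (h : frobNorm (normAdj g) ≤ ca) :
    ∑ j, Real.sqrt (∑ l, laterCoeff g j l ^ 2)
      ≤ (n - 1) / n * ca * Real.sqrt (n / 2) := by
  have hn1 : (1 : ℝ) ≤ n := by exact_mod_cast hn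
  have h1 := sq_sum_le_card_mul_sum_sq (s := (Finset.univ : Finset (Fin n)))
    (f := fun j => Real.sqrt (∑ l, laterCoeff g j l ^ 2))
  have h2 : ∀ j, Real.sqrt (∑ l, laterCoeff g j l ^ 2) ^ 2 = ∑ l, laterCoeff g j l ^ 2 := fun j =>
    Real.sq_sqrt (Finset.sum_nonneg fun l _ => sq_nonneg _)
  simp only [h2, Finset.card_univ, Fintype.card_fin] at h1
  have h3 := sum_laterCoeff_sq_le g h
  have h0 : 0 ≤ (n - 1) / n * ca * Real.sqrt (n / 2) := by
    have : (0 : ℝ) ≤ n - 1 := by linarith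
    positivity
  refine (le_abs_self _).trans (abs_le_of_sq_le_sq ?_ h0)
  calc _ ≤ (n : ℝ) * (((n - 1) / n : ℝ) ^ 2 * (ca ^ 2 / 2)) :=
        h1.trans (mul_le_mul_of_nonneg_left h3 (by positivity))
    _ = _ := by
        rw [mul_pow, mul_pow, Real.sq_sqrt (by positivity)]
        ring

end Coefficients

/-! ### Numerical inequalities behind the constants. -/

section Numeric

/-- A rational upper bound for `e` reduces lower bounds on logarithms to comparisons of rational
powers. -/
lemma div_le_log {k m : ℕ} (hm : 0 < m) {x : ℝ} (hx : 0 < x)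
    (h : (2.7182818286 : ℝ) ^ k ≤ x ^ m) : (k : ℝ) / m ≤ Real.log x := by
  rw [div_le_iff₀ (by exact_mod_cast hm), mul_comm, ← Real.log_pow, Real.le_log_iff_exp_le (by positivity)]
  rw [← Real.exp_one_pow]
  exact (pow_le_pow_left₀ (Real.exp_pos _).le Real.exp_one_lt_d9.le k).trans h

/-- This is the discriminant condition for the quadratic in `q` of `sq_mul_two_add_sq_le`. On each
range of `n` the logarithm is bounded below by a rational `k / m` valid at the left endpoint, which
leaves a polynomial inequality. -/
lemma four_mul_sq_le_log {n : ℕ} (hn : 0 < n) :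
    4 * ((n : ℝ) - 1) ^ 2 ≤ Real.log (2 * n) * ((n : ℝ) ^ 2 + 2 * n - 1) := by
  have hn1 : (1 : ℝ) ≤ n := by exact_mod_cast hn
  have hpos : (0 : ℝ) ≤ (n : ℝ) ^ 2 + 2 * n - 1 := by nlinarith
  have key : ∀ (k m : ℕ) (lo hi : ℝ), 0 < m → 0 < lo → lo ≤ n → n ≤ hi →
      (2.7182818286 : ℝ) ^ k ≤ (2 * lo) ^ m →
      (∀ t : ℝ, lo ≤ t → t ≤ hi → 4 * (t - 1) ^ 2 ≤ (k : ℝ) / m * (t ^ 2 + 2 * t - 1)) →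
      4 * ((n : ℝ) - 1) ^ 2 ≤ Real.log (2 * n) * ((n : ℝ) ^ 2 + 2 * n - 1) := by
    intro k m lo hi hm hlo h1 h2 h3 h4
    refine (h4 n h1 h2).trans (mul_le_mul_of_nonneg_right ?_ hpos)
    exact (div_le_log hm (by positivity) h3).trans
      (Real.log_le_log (by positivity) (by linarith))
  have c : ∀ {a : ℕ}, a ≤ n → (a : ℝ) ≤ n := fun h => by exact_mod_cast h
  have c' : ∀ {b : ℕ}, n ≤ b → (n : ℝ) ≤ b := fun h => by exact_mod_cast h
  have : n ≤ 2 ∨ (3 ≤ n ∧ n ≤ 4) ∨ (5 ≤ n ∧ n ≤ 6) ∨ (7 ≤ n ∧ n ≤ 8) ∨ (9 ≤ n ∧ n ≤ 10)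
      ∨ (11 ≤ n ∧ n ≤ 13) ∨ (14 ≤ n ∧ n ≤ 17) ∨ (18 ≤ n ∧ n ≤ 26) ∨ (27 ≤ n ∧ n ≤ 60)
      ∨ 61 ≤ n := by omega
  rcases this with h | ⟨h, h'⟩ | ⟨h, h'⟩ | ⟨h, h'⟩ | ⟨h, h'⟩ | ⟨h, h'⟩ | ⟨h, h'⟩ | ⟨h, h'⟩ | ⟨h, h'⟩ | h
  · refine key 3 5 1 2 (by norm_num) (by norm_num) hn1 (c' h) (by norm_num) fun t h1 h2 => ?_
    push_cast; nlinarith [mul_nonneg (sub_nonneg.2 h1) (sub_nonneg.2 h2)]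
  · refine key 8 5 3 4 (by norm_num) (by norm_num) (c h) (c' h') (by norm_num) fun t h1 h2 => ?_
    push_cast; nlinarith [mul_nonneg (sub_nonneg.2 h1) (sub_nonneg.2 h2)]
  · refine key 11 5 5 6 (by norm_num) (by norm_num) (c h) (c' h') (by norm_num) fun t h1 h2 => ?_
    push_cast; nlinarith [mul_nonneg (sub_nonneg.2 h1) (sub_nonneg.2 h2)]
  · refine key 5 2 7 8 (by norm_num) (by norm_num) (c h) (c' h') (by norm_num) fun t h1 h2 => ?_
    push_cast; nlinarith [mul_nonneg (sub_nonneg.2 h1) (sub_nonneg.2 h2)]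
  · refine key 11 4 9 10 (by norm_num) (by norm_num) (c h) (c' h') (by norm_num) fun t h1 h2 => ?_
    push_cast; nlinarith [mul_nonneg (sub_nonneg.2 h1) (sub_nonneg.2 h2)]
  · refine key 3 1 11 13 (by norm_num) (by norm_num) (c h) (c' h') (by norm_num) fun t h1 h2 => ?_
    push_cast; nlinarith [mul_nonneg (sub_nonneg.2 h1) (sub_nonneg.2 h2)]
  · refine key 16 5 14 17 (by norm_num) (by norm_num) (c h) (c' h') (by norm_num) fun t h1 h2 => ?_
    push_cast; nlinarith [mul_nonneg (sub_nonneg.2 h1) (sub_nonneg.2 h2)]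
  · refine key 7 2 18 26 (by norm_num) (by norm_num) (c h) (c' h') (by norm_num) fun t h1 h2 => ?_
    push_cast; nlinarith [mul_nonneg (sub_nonneg.2 h1) (sub_nonneg.2 h2)]
  · refine key 15 4 27 60 (by norm_num) (by norm_num) (c h) (c' h') (by norm_num) fun t h1 h2 => ?_
    push_cast; nlinarith [mul_nonneg (sub_nonneg.2 h1) (sub_nonneg.2 h2)]
  · refine key 4 1 61 n (by norm_num) (by norm_num) (c h) le_rfl (by norm_num) fun t h1 h2 => ?_
    push_cast; nlinarith

/-- The margin between the logarithmic terms that absorbs the mean of the fluctuations. -/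
lemma sq_mul_two_add_sq_le {n : ℕ} (hn : 0 < n) (q : ℝ) :
    ((n : ℝ) - 1) ^ 2 * (2 + q) ^ 2 ≤ 4 * (n : ℝ) ^ 2 * (q ^ 2 / 2 + Real.log (2 * n) / 2) := by
  have hn1 : (1 : ℝ) ≤ n := by exact_mod_cast hn
  have h := four_mul_sq_le_log hn
  set R := Real.log (2 * n)
  set N : ℝ := (n : ℝ)
  have hA : 0 < N ^ 2 + 2 * N - 1 := by nlinarith
  have h2 : 0 ≤ (N ^ 2 + 2 * N - 1) *
      (4 * N ^ 2 * (q ^ 2 / 2 + R / 2) - (N - 1) ^ 2 * (2 + q) ^ 2) := by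
    -- Completing the square in `q`; `N² + 2N - 1 = 2N² - (N - 1)²` is the leading coefficient of
    -- the difference.
    have h3 : (N ^ 2 + 2 * N - 1) *
        (4 * N ^ 2 * (q ^ 2 / 2 + R / 2) - (N - 1) ^ 2 * (2 + q) ^ 2)
        = ((N ^ 2 + 2 * N - 1) * q - 2 * (N - 1) ^ 2) ^ 2
          + 2 * N ^ 2 * (R * (N ^ 2 + 2 * N - 1) - 4 * (N - 1) ^ 2) := by ring
    rw [h3]
    have h4 : 0 ≤ R * (N ^ 2 + 2 * N - 1) - 4 * (N - 1) ^ 2 := sub_nonneg.2 h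
    positivity
  have := nonneg_of_mul_nonneg_right h2 hA
  linarith

/-- The first term pays for the failure probability `δ/2`, the second for the mean of the
fluctuations. -/
lemma log_two_sqrt_div {n : ℕ} (hn : 0 < n) {δ : ℝ} (hδ : 0 < δ) :
    Real.log (2 * Real.sqrt (2 * n) / δ) = Real.log (2 / δ) + Real.log (2 * n) / 2 := by
  have hn1 : (0 : ℝ) < n := by exact_mod_cast hn
  rw [mul_div_right_comm, Real.log_mul (by positivity) (by positivity), Real.log_sqrt (by positivity)]

/-- The right-hand side is the value of `b` for which the Chernoff level `(2 + q) c ‖Γ‖ b` equals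
the threshold used in `measure_meanDist_ge_le`. -/
lemma coeff_bound_le {n : ℕ} (hn : 0 < n) {ca δ : ℝ} (hca : 0 ≤ ca) (hδ0 : 0 < δ) (hδ1 : δ < 1) :
    (n - 1) / n * ca * Real.sqrt (n / 2)
      ≤ 2 * n * ca * Real.sqrt (Real.log (2 * Real.sqrt (2 * n) / δ) / (2 * n - 1))
        / (2 + Real.sqrt (2 * Real.log (2 / δ))) := by
  have hn1 : (1 : ℝ) ≤ n := by exact_mod_cast hn
  have hl : 0 ≤ Real.log (2 / δ) := Real.log_nonneg (by rw [le_div_iff₀ hδ0]; linarith)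
  have hl2 : 0 ≤ Real.log (2 * n) := Real.log_nonneg (by linarith)
  set q := Real.sqrt (2 * Real.log (2 / δ)) with hq
  have hq0 : 0 ≤ q := Real.sqrt_nonneg _
  have hqsq : q ^ 2 = 2 * Real.log (2 / δ) := Real.sq_sqrt (by positivity)
  have h := sq_mul_two_add_sq_le hn q
  rw [log_two_sqrt_div hn hδ0, le_div_iff₀ (by positivity)]
  have h2n : (0 : ℝ) < 2 * n - 1 := by linarith
  have key : (n - 1) / n * Real.sqrt (n / 2) * (2 + q)
      ≤ 2 * n * Real.sqrt ((Real.log (2 / δ) + Real.log (2 * n) / 2) / (2 * n - 1)) := by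
    refine (le_abs_self _).trans (abs_le_of_sq_le_sq ?_ (by positivity))
    rw [mul_pow, mul_pow, mul_pow, Real.sq_sqrt (by positivity), Real.sq_sqrt (by positivity)]
    have h3 : Real.log (2 / δ) = q ^ 2 / 2 := by rw [hqsq]; ring
    rw [h3]
    set Λ := q ^ 2 / 2 + Real.log (2 * n) / 2
    have hΛ : 0 ≤ Λ := by positivity
    calc ((n - 1) / n : ℝ) ^ 2 * (n / 2) * (2 + q) ^ 2
        = (((n : ℝ) - 1) ^ 2 * (2 + q) ^ 2) / (2 * n) := by field_simp
      _ ≤ (4 * (n : ℝ) ^ 2 * Λ) / (2 * n) := by gcongr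
      _ ≤ (4 * (n : ℝ) ^ 2 * Λ) / (2 * n - 1) := by
          gcongr
          linarith
      _ = _ := by ring
  calc (n - 1) / n * ca * Real.sqrt (n / 2) * (2 + q)
      = ca * ((n - 1) / n * Real.sqrt (n / 2) * (2 + q)) := by ring
    _ ≤ ca * _ := mul_le_mul_of_nonneg_left key hca
    _ = _ := by ring

end Numeric

/-! ### Nonnegativity of the Rényi divergence. -/

section Renyi

variable {Z : Type*} [MeasurableSpace Z]

/-- Rényi divergence is nonnegative. -/
lemma renyiDiv_nonneg {a : ℝ} (ha0 : 0 < a) (ha1 : a ≠ 1) (Q P : Measure Z)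
    [IsProbabilityMeasure Q] [IsProbabilityMeasure P] (hQP : Q ≪ P) : 0 ≤ renyiDiv a Q P := by
  have h1 : ∫⁻ w, Q.rnDeriv P w ∂P = 1 := by rw [Measure.lintegral_rnDeriv hQP, measure_univ]
  have hm : AEStronglyMeasurable (Q.rnDeriv P) P :=
    (Measure.measurable_rnDeriv Q P).aestronglyMeasurable
  unfold renyiDiv
  -- The density has `L¹` norm `1`, and `Lᵖ` norms increase in the exponent on a probability space.
  -- The logarithm therefore has the sign of `a - 1`, and so does the prefactor.
  rcases lt_or_gt_of_ne ha1 with h | h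
  · have h2 := eLpNorm'_le_eLpNorm'_of_exponent_le ha0 h.le P hm
    simp only [eLpNorm', enorm_eq_self, ENNReal.rpow_one, h1, one_div, inv_one] at h2
    have h3 : ∫⁻ w, (Q.rnDeriv P w) ^ a ∂P ≤ 1 := by
      rwa [ENNReal.rpow_inv_le_iff ha0, ENNReal.one_rpow] at h2
    have h4 : ENNReal.log (∫⁻ w, (Q.rnDeriv P w) ^ a ∂P) ≤ 0 := by
      rw [← ENNReal.log_one]; exact ENNReal.log_monotone h3
    have h5 : (((a - 1)⁻¹ : ℝ) : EReal) ≤ 0 := by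
      exact_mod_cast inv_nonpos.2 (by linarith)
    rw [← neg_mul_neg]
    exact mul_nonneg (EReal.neg_nonneg.2 h5) (EReal.neg_nonneg.2 h4)
  · have h2 := eLpNorm'_le_eLpNorm'_of_exponent_le one_pos h.le P hm
    simp only [eLpNorm', enorm_eq_self, ENNReal.rpow_one, h1, one_div, inv_one] at h2
    have h3 : 1 ≤ ∫⁻ w, (Q.rnDeriv P w) ^ a ∂P := by
      rwa [ENNReal.le_rpow_inv_iff ha0, ENNReal.one_rpow] at h2
    have h4 : 0 ≤ ENNReal.log (∫⁻ w, (Q.rnDeriv P w) ^ a ∂P) := by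
      rw [← ENNReal.log_one]; exact ENNReal.log_monotone h3
    refine mul_nonneg ?_ h4
    exact_mod_cast inv_nonneg.2 (by linarith)

end Renyi

/-! ### From fixed graphs to the random graph. -/

section HighProbability

instance (V : Type*) [Countable V] : MeasurableSingletonClass (SimpleGraph V) where
  measurableSet_singleton g := by
    refine ⟨{g.Adj}, measurableSet_singleton _, ?_⟩
    ext h
    simp only [Set.mem_preimage, Set.mem_singleton_iff]
    exact ⟨fun e => SimpleGraph.ext e, fun e => e ▸ rfl⟩

variable {d : ℕ} {Y : Type*} [MeasurableSpace Y] [MeasurableSingletonClass Y]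
  {X : Set (EuclideanSpace ℝ (Fin d))}

/-- With high probability, the mean distances are small. -/
lemma measure_meanDist_ge_le {Ω : Type*} [MeasurableSpace Ω] (μ : Measure Ω)
    [IsProbabilityMeasure μ] {n : ℕ} (hn : 0 < n) {𝒜 : Set (SimpleGraph (Fin n))}
    (κ : (i : ℕ) → Kernel (Fin i → DataPt X Y) (DataPt X Y)) [∀ i, IsMarkovKernel (κ i)]
    (U : Ω → Fin n → DataPt X Y) (hU : Measurable U) (x₀ : Fin 0 → DataPt X Y)
    (hlaw : μ.map U = pathLaw κ 0 n x₀)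
    (A : Ω → SimpleGraph (Fin n)) (hA : Measurable A) (hA𝒜 : ∀ ω, A ω ∈ 𝒜)
    (hind : IndepFun U A μ)
    {cx ca : ℝ} (hcx : 0 < cx) (hca : 0 < ca) (hX : ∀ x ∈ X, ‖x‖ ≤ cx)
    (h𝒜 : ∀ g ∈ 𝒜, frobNorm (normAdj g) ≤ ca) {δ : ℝ} (hδ0 : 0 < δ) (hδ1 : δ < 1) :
    MeasurableSet {ω | cx * specNorm (Gam κ n) * (2 * n * ca *
        Real.sqrt (Real.log (2 * Real.sqrt (2 * n) / δ) / (2 * n - 1)))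
        ≤ ∑ j, meanDist κ feature (laterCoeff (A ω) j) j (U ω)} ∧
    μ {ω | cx * specNorm (Gam κ n) * (2 * n * ca *
        Real.sqrt (Real.log (2 * Real.sqrt (2 * n) / δ) / (2 * n - 1)))
        ≤ ∑ j, meanDist κ feature (laterCoeff (A ω) j) j (U ω)}
      ≤ ENNReal.ofReal (δ / 2) := by
  have hn1 : (1 : ℝ) ≤ n := by exact_mod_cast hn
  set q := Real.sqrt (2 * Real.log (2 / δ)) with hq
  have hl : 0 < Real.log (2 / δ) := Real.log_pos (by rw [lt_div_iff₀ hδ0]; linarith)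
  have hq0 : 0 ≤ q := Real.sqrt_nonneg _
  have hqsq : q ^ 2 = 2 * Real.log (2 / δ) := Real.sq_sqrt (by positivity)
  have hΛ : 0 < Real.log (2 * Real.sqrt (2 * n) / δ) := by
    rw [log_two_sqrt_div hn hδ0]
    have : 0 ≤ Real.log (2 * n) := Real.log_nonneg (by linarith)
    positivity
  have h2n : (0 : ℝ) < 2 * n - 1 := by linarith
  set b := 2 * n * ca * Real.sqrt (Real.log (2 * Real.sqrt (2 * n) / δ) / (2 * n - 1)) / (2 + q)
    with hb
  have hb0 : 0 < b := by positivity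
  have hthr : cx * specNorm (Gam κ n) * (2 * n * ca *
        Real.sqrt (Real.log (2 * Real.sqrt (2 * n) / δ) / (2 * n - 1)))
      = (2 + q) * (cx * specNorm (Gam κ n) * b) := by
    rw [hb]; field_simp
  rw [hthr]
  have hcx' : ∀ t : DataPt X Y, ‖feature t‖ ≤ cx := fun t => hX _ t.1.2
  have hfun : Measurable fun p : (Fin n → DataPt X Y) × SimpleGraph (Fin n) =>
      ∑ j, meanDist κ feature (laterCoeff p.2 j) j p.1 :=
    measurable_from_prod_countable_left fun g => by
      have h : ∀ j ∈ (Finset.univ : Finset (Fin n)),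
          Measurable (meanDist κ feature (laterCoeff g j) j) := fun j _ =>
        measurable_meanDist κ measurable_feature _ j
      exact Finset.measurable_fun_sum _ h
  let D : Set ((Fin n → DataPt X Y) × SimpleGraph (Fin n)) :=
    {p | (2 + q) * (cx * specNorm (Gam κ n) * b)
      ≤ ∑ j, meanDist κ feature (laterCoeff p.2 j) j p.1}
  have hDm : MeasurableSet D := measurableSet_le measurable_const hfun
  have hUA : Measurable fun ω => (U ω, A ω) := hU.prodMk hA
  have : IsProbabilityMeasure (μ.map A) := Measure.isProbabilityMeasure_map hA.aemeasurable
  have hsec : ∀ g ∈ 𝒜, pathLaw κ 0 n x₀ ((fun s => (s, g)) ⁻¹' D) ≤ ENNReal.ofReal (δ / 2) := by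
    intro g hg
    have h1 := measure_sum_meanDist_ge_le κ measurable_feature hcx hcx' hn (laterCoeff g) hb0
      ((sum_sqrt_laterCoeff_le hn g hca.le (h𝒜 g hg)).trans
        (coeff_bound_le hn hca.le hδ0 hδ1)) (show 2 ≤ 2 + q by linarith) x₀
    -- The choice `q² = 2 log (2/δ)` makes the Chernoff bound exactly `δ/2`.
    have h2 : Real.exp (-((2 + q - 2) ^ 2 / 2)) = δ / 2 := by
      have : -((2 + q - 2) ^ 2 / 2) = Real.log (δ / 2) := by
        rw [add_sub_cancel_left, hqsq, ← inv_div 2 δ, Real.log_inv]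
        ring
      rw [this, Real.exp_log (by positivity)]
    rw [h2] at h1
    exact (ENNReal.le_ofReal_iff_toReal_le (measure_ne_top _ _) (by positivity)).2 h1
  have hae : ∀ᵐ g ∂(μ.map A), g ∈ 𝒜 := by
    exact (ae_map_iff (p := (· ∈ 𝒜)) hA.aemeasurable (Set.toFinite 𝒜).measurableSet).2
      (.of_forall hA𝒜)
  -- Independence makes the joint law a product, so the tail bound for each fixed admissible graph
  -- integrates over the graph.
  have hD : μ ((fun ω => (U ω, A ω)) ⁻¹' D) ≤ ENNReal.ofReal (δ / 2) := by
    rw [← Measure.map_apply hUA hDm,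
      (indepFun_iff_map_prod_eq_prod_map_map hU.aemeasurable hA.aemeasurable).1 hind, hlaw,
      Measure.prod_apply_symm hDm]
    calc _ ≤ ∫⁻ _, ENNReal.ofReal (δ / 2) ∂(μ.map A) :=
          lintegral_mono_ae (hae.mono fun g hg => hsec g hg)
      _ = _ := by simp
  exact ⟨hUA hDm, hD⟩

end HighProbability

end GCN

/-! ### Assembly of the bound. -/

theorem proposition2
    {Ω : Type*} [MeasurableSpace Ω] (μ : Measure Ω) [IsProbabilityMeasure μ]
    {n d : ℕ} (hn : 0 < n)
    {Y : Type*} [Fintype Y] [DecidableEq Y] [MeasurableSpace Y] [MeasurableSingletonClass Y]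
    -- feature set, set of admissible graphs, parameter set
    (X : Set (EuclideanSpace ℝ (Fin d)))
    (𝒜 : Set (SimpleGraph (Fin n)))
    (𝒲 : Set (Matrix (Fin d) Y ℝ))
    -- the data points `S 0, …, S (n - 1)` and the new one `S n`; the graph; the coefficients
    -- of the new node
    (S : Fin (n + 1) → Ω → GCN.DataPt X Y) (hS : ∀ i, Measurable (S i))
    (A : Ω → SimpleGraph (Fin n)) (hA : Measurable A) (hA𝒜 : ∀ ω, A ω ∈ 𝒜)
    (B : Ω → Fin (n + 1) → ℝ) (hB : Measurable B)
    -- the conditional law of each data point given the previous ones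
    (κ : (i : ℕ) → Kernel (Fin i → GCN.DataPt X Y) (GCN.DataPt X Y)) [∀ i, IsMarkovKernel (κ i)]
    (hκ : ∀ i : Fin (n + 1),
      HasCondDistrib (S i) (fun ω => Fin.take i i.2.le (fun k => S k ω)) (κ i) μ)
    -- the conditional law of the coefficients of the new node given the graph
    (β : Kernel (SimpleGraph (Fin n)) (Fin (n + 1) → ℝ)) [IsMarkovKernel β]
    (hβ : HasCondDistrib B A β μ)
    -- the conditional law of the new data point and its coefficients given the training data
    (ρ : Kernel ((Fin n → GCN.DataPt X Y) × SimpleGraph (Fin n))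
      (GCN.DataPt X Y × (Fin (n + 1) → ℝ))) [IsMarkovKernel ρ]
    (hρ : HasCondDistrib (fun ω => (S (Fin.last n) ω, B ω))
      (fun ω => (Fin.init (fun k => S k ω), A ω)) ρ μ)
    -- independence assumptions
    (hind : IndepFun (fun ω => Fin.init (fun k => S k ω)) A μ)
    (hfac : ∀ᵐ z ∂(μ.map (fun ω => (Fin.init (fun k => S k ω), A ω))),
      ρ z = (κ n z.1).prod (β z.2))
    -- activation and loss, and the boundedness and regularity assumptions
    (φ : ℝ → ℝ) (hφ : LipschitzWith 1 φ)
    (ℓ : EuclideanSpace ℝ Y → Y → ℝ)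
    (cx ca cw L M : ℝ) (hcx : 0 < cx) (hca : 0 < ca) (hcw : 0 < cw) (hL : 0 < L) (hM : 0 < M)
    (hX : ∀ x ∈ X, ‖x‖ ≤ cx)
    (h𝒜 : ∀ g ∈ 𝒜, GCN.frobNorm (GCN.normAdjSelf g) ≤ ca ∧ GCN.frobNorm (GCN.normAdj g) ≤ ca)
    (h𝒲 : ∀ w ∈ 𝒲, GCN.specNorm w ≤ cw)
    (hℓL : ∀ u v y, |ℓ u y - ℓ v y| ≤ L * ‖v - u‖)
    (hℓ0 : ∀ u y, 0 ≤ ℓ u y) (hℓM : ∀ u y, ℓ u y ≤ M)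
    -- prior, and posterior (which may depend on the training data)
    (P : Measure 𝒲) [IsProbabilityMeasure P]
    (δ : ℝ) (hδ0 : 0 < δ) (hδ1 : δ < 1)
    (α : ℝ) (hα0 : 0 < α) (hα1 : α ≠ 1)
    (Q : (Fin n → GCN.DataPt X Y) × SimpleGraph (Fin n) → Measure 𝒲)
    (hQ : ∀ z, IsProbabilityMeasure (Q z)) (hQP : ∀ z, Q z ≪ P) :
    ∃ G : Set Ω, MeasurableSet G ∧ ENNReal.ofReal (1 - δ / 2) ≤ μ G ∧ ∀ ω ∈ G,
      ∀ s : Fin n → GCN.DataPt X Y, s = Fin.init (fun k => S k ω) →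
      ∀ D : EReal, D = GCN.renyiDiv α (Q (s, A ω)) P → D ≠ ⊤ →
        ∫ w, GCN.gapTwo φ ℓ κ ρ w.1 s (A ω) ∂(Q (s, A ω)) ≤
          (M / n) * ∑ i : Fin n, GCN.tvDist (κ n s) (κ i (Fin.take i i.2.le s))
          + (M / n) * ∑ i : Fin n,
              ∫ ω', GCN.tvDist
                (GCN.productLaw κ i (Fin.take i (i.2.le.trans n.le_succ) (fun k => S k ω')))
                (GCN.jointLaw κ i (Fin.take i (i.2.le.trans n.le_succ) (fun k => S k ω'))) ∂μ
          + M * GCN.tvDist (β (A ω)) (GCN.auxLaw (A ω))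
          + Real.sqrt ((2 * cx * cw * ca * L + M * GCN.rowSumNorm (GCN.GamTilde κ n)) ^ 2
              * (D.toReal + Real.log (2 * Real.sqrt (2 * n) / δ))
              * GCN.specNorm (GCN.Gam κ n) ^ 2 / (2 * n - 1)) := by
  have : NeZero n := ⟨hn.ne'⟩
  have hn1 : (1 : ℝ) ≤ n := by exact_mod_cast hn
  have h2n : (0 : ℝ) < 2 * n - 1 := by linarith
  have hSm : Measurable fun ω => (Fin.init (fun k => S k ω) : Fin n → GCN.DataPt X Y) :=
    (GCN.measurable_take n.le_succ).comp (measurable_pi_lambda _ hS)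
  have hlaw : μ.map (fun ω => (Fin.init (fun k => S k ω) : Fin n → GCN.DataPt X Y))
      = GCN.pathLaw κ 0 n (fun i => i.elim0) :=
    GCN.map_eq_pathLaw κ μ S hS hκ n.le_succ _
  obtain ⟨hbm, hbad⟩ := GCN.measure_meanDist_ge_le μ hn κ _ hSm _ hlaw A hA hA𝒜 hind hcx hca hX
    (fun g hg => (h𝒜 g hg).2) hδ0 hδ1
  set bad := {ω | cx * GCN.specNorm (GCN.Gam κ n) * (2 * n * ca *
        Real.sqrt (Real.log (2 * Real.sqrt (2 * n) / δ) / (2 * n - 1)))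
        ≤ ∑ j, GCN.meanDist κ GCN.feature (GCN.laterCoeff (A ω) j) j (Fin.init (fun k => S k ω))}
    with hbad_def
  have hfac' : ∀ᵐ ω ∂μ, ρ (Fin.init (fun k => S k ω), A ω)
      = (κ n (Fin.init (fun k => S k ω))).prod (β (A ω)) :=
    ae_of_ae_map (hSm.prodMk hA).aemeasurable hfac
  -- The set where the factorization fails is null but not evidently measurable; its measurable hull
  -- keeps the good event measurable.
  set N := toMeasurable μ {ω | ¬ ρ (Fin.init (fun k => S k ω), A ω)
      = (κ n (Fin.init (fun k => S k ω))).prod (β (A ω))} with hN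
  have hN0 : μ N = 0 := by rw [hN, measure_toMeasurable]; exact hfac'
  have hNm : MeasurableSet N := measurableSet_toMeasurable _ _
  refine ⟨(bad ∪ N)ᶜ, (hbm.union hNm).compl, ?_, ?_⟩
  · rw [prob_compl_eq_one_sub (hbm.union hNm), ENNReal.ofReal_sub _ (by positivity),
      ENNReal.ofReal_one]
    refine tsub_le_tsub_left ((measure_union_le _ _).trans ?_) _
    rw [hN0, add_zero]
    exact hbad
  intro ω hω s hs D hD hDtop
  have hρω : ρ (s, A ω) = (κ n s).prod (β (A ω)) := by
    by_contra hne
    exact hω (Or.inr (subset_toMeasurable _ _ (by rw [hs] at hne; exact hne)))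
  have hdist : ∑ j, GCN.meanDist κ GCN.feature (GCN.laterCoeff (A ω) j) j s
      ≤ cx * GCN.specNorm (GCN.Gam κ n) * (2 * n * ca *
        Real.sqrt (Real.log (2 * Real.sqrt (2 * n) / δ) / (2 * n - 1))) := by
    rw [hs]
    by_contra hlt
    exact hω (Or.inl (not_le.1 hlt).le)
  have hQω := hQ (s, A ω)
  have hD0 : 0 ≤ D.toReal := by
    refine EReal.toReal_nonneg ?_
    rw [hD]
    exact GCN.renyiDiv_nonneg hα0 hα1 _ _ (hQP _)
  have hg0 : 0 ≤ GCN.specNorm (GCN.Gam κ n) := norm_nonneg _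
  have hγ0 : 0 ≤ GCN.rowSumNorm (GCN.GamTilde κ n) :=
    Real.iSup_nonneg fun i => Finset.sum_nonneg fun j _ => abs_nonneg _
  have hΛ0 : 0 ≤ Real.log (2 * Real.sqrt (2 * n) / δ) := by
    rw [GCN.log_two_sqrt_div hn hδ0]
    have h1 : 0 ≤ Real.log (2 * n) := Real.log_nonneg (by linarith)
    have h2 : 0 ≤ Real.log (2 / δ) := Real.log_nonneg (by rw [le_div_iff₀ hδ0]; linarith)
    positivity
  -- The left-hand side is the square-root term with divergence and `Γ̃` contribution both set to
  -- `0`, and that term is monotone in each.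
  have hsqrt : L * cw / n * (cx * GCN.specNorm (GCN.Gam κ n) * (2 * n * ca *
        Real.sqrt (Real.log (2 * Real.sqrt (2 * n) / δ) / (2 * n - 1))))
      ≤ Real.sqrt ((2 * cx * cw * ca * L + M * GCN.rowSumNorm (GCN.GamTilde κ n)) ^ 2
              * (D.toReal + Real.log (2 * Real.sqrt (2 * n) / δ))
              * GCN.specNorm (GCN.Gam κ n) ^ 2 / (2 * n - 1)) := by
    refine Real.le_sqrt_of_sq_le ?_
    calc _ = (2 * cx * cw * ca * L) ^ 2
              * (Real.sqrt (Real.log (2 * Real.sqrt (2 * n) / δ) / (2 * n - 1))) ^ 2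
              * GCN.specNorm (GCN.Gam κ n) ^ 2 := by
          field_simp
      _ = (2 * cx * cw * ca * L) ^ 2 * (0 + Real.log (2 * Real.sqrt (2 * n) / δ))
              * GCN.specNorm (GCN.Gam κ n) ^ 2 / (2 * n - 1) := by
          rw [Real.sq_sqrt (by positivity)]
          ring
      _ ≤ _ := by
          gcongr
          exact le_add_of_nonneg_right (by positivity)
  have h1 : 0 ≤ (M / n) * ∑ i : Fin n, GCN.tvDist (κ n s) (κ i (Fin.take i i.2.le s)) :=
    mul_nonneg (by positivity) (Finset.sum_nonneg fun i _ => GCN.tvDist_nonneg _ _)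
  have h2 : 0 ≤ (M / n) * ∑ i : Fin n, ∫ ω', GCN.tvDist
      (GCN.productLaw κ i (Fin.take i (i.2.le.trans n.le_succ) (fun k => S k ω')))
      (GCN.jointLaw κ i (Fin.take i (i.2.le.trans n.le_succ) (fun k => S k ω'))) ∂μ :=
    mul_nonneg (by positivity) (Finset.sum_nonneg fun i _ =>
      integral_nonneg fun _ => GCN.tvDist_nonneg _ _)
  have h3 : 0 ≤ M * GCN.tvDist (β (A ω)) (GCN.auxLaw (A ω)) :=
    mul_nonneg hM.le (GCN.tvDist_nonneg _ _)
  have hpt : ∀ w : 𝒲, GCN.gapTwo φ ℓ κ ρ w.1 s (A ω)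
      ≤ (M / n) * ∑ i : Fin n, GCN.tvDist (κ n s) (κ i (Fin.take i i.2.le s))
        + M * GCN.tvDist (β (A ω)) (GCN.auxLaw (A ω))
        + L * cw / n * (cx * GCN.specNorm (GCN.Gam κ n) * (2 * n * ca *
        Real.sqrt (Real.log (2 * Real.sqrt (2 * n) / δ) / (2 * n - 1)))) := by
    intro w
    refine (GCN.gapTwo_le hφ hL.le hM.le hX hℓL hℓ0 hℓM κ β ρ s (A ω) hρω (h𝒲 w.1 w.2)).trans ?_
    gcongr
  have h4 : 0 ≤ L * cw / n * (cx * GCN.specNorm (GCN.Gam κ n) * (2 * n * ca *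
        Real.sqrt (Real.log (2 * Real.sqrt (2 * n) / δ) / (2 * n - 1)))) := by positivity
  have hint : ∫ w, GCN.gapTwo φ ℓ κ ρ w.1 s (A ω) ∂(Q (s, A ω))
      ≤ (M / n) * ∑ i : Fin n, GCN.tvDist (κ n s) (κ i (Fin.take i i.2.le s))
        + M * GCN.tvDist (β (A ω)) (GCN.auxLaw (A ω))
        + L * cw / n * (cx * GCN.specNorm (GCN.Gam κ n) * (2 * n * ca *
        Real.sqrt (Real.log (2 * Real.sqrt (2 * n) / δ) / (2 * n - 1)))) := by
    -- If the gap is not integrable in the parameter, its integral is `0` by convention and the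
    -- nonnegative right-hand side suffices.
    by_cases hi : Integrable (fun w : 𝒲 => GCN.gapTwo φ ℓ κ ρ w.1 s (A ω)) (Q (s, A ω))
    · exact (integral_mono hi (integrable_const _) hpt).trans (by simp)
    · rw [integral_undef hi]
      positivity
  linarith
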